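/- For a finite positive compactly supported measure $\rho$ on $\mathbb R$ with mass $c=\rho(\mathbb R)$, the compound Poisson law $p_\rho$ and the compound free Poisson law $\pi_\rho$ are the probability measures on $\mathbb R$ defined as weak limits $$p_\rho=\lim_{n\to\infty}\left(\left(1-\tfrac{c}{n}\right)\delta_0+\tfrac1n\rho\right)^{*n},\qquad \pi_\rho=\lim_{n\to\infty}\left(\left(1-\tfrac{c}{n}\right)\delta_0+\tfrac1n\rho\right)^{\boxplus n},$$ where $*$ is the convolution of measures and $\boxplus$ is Voiculescu's free convolution: $\mu\boxplus\nu$ is the law of $a+b$, for $a,b$ free selfadjoint noncommutative random variables with laws $\mu,\nu$. (The law of a selfadjoint element $a$ of a unital complex $*$-algebra with a state $\varphi$ is the compactly supported probability measure $\mu$ on $\mathbb R$ with $\varphi(a^k)=\int x^k\,d\mu(x)$ for all $k\ge 0$, when it exists.) **Theorem.** Let $\rho=\sum_{i=1}^s c_i\delta_{z_i}$ with $c_i>0$ and $z_i\in\mathbb R$. 1. The compound Poisson law $p_\rho$ exists and is unique. If $\alpha_1,\dots,\alpha_s$ are independent real random variables on a probability space, with $\alpha_i$ following the Poisson law of parameter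 $c_i$, then $p_\rho$ is the law of $\sum_{i=1}^s z_i\alpha_i$. 2. The compound free Poisson law $\pi_\rho$ exists and is unique. If $\alpha_1,\dots,\alpha_s$ are free selfadjoint elements of a unital complex $*$-algebra endowed with a state, with $\alpha_i$ following the free Poisson law of parameter $c_i$, that is, the law $\pi_{c_i\delta_1}$, then $\pi_\rho$ is the law of $\sum_{i=1}^s z_i\alpha_i$. -/

import Mathlib

open MeasureTheory ProbabilityTheory Filter Topology
open scoped NNReal ENNReal

/-! ### Noncommutative probability -/

/-- `φ` is a state on the unital complex `*`-algebra `A`: a linear functional which is unital and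
positive. The pair `(A, φ)` is then a (noncommutative) `*`-probability space. -/
structure IsNCState {A : Type*} [Ring A] [StarRing A] [Algebra ℂ A] (φ : A →ₗ[ℂ] ℂ) : Prop where
  map_one : φ 1 = 1
  re_nonneg : ∀ a : A, 0 ≤ (φ (star a * a)).re
  im_eq_zero : ∀ a : A, (φ (star a * a)).im = 0

/-- Freeness of a family of unital subalgebras: a product of centred elements, in which
neighbouring factors come from subalgebras with different indices, is centred. The pair `(i, x)`
in the list stands for the factor `x`, taken in the `i`-th subalgebra. -/
def AreFreeSubalgebras {A ι : Type*} [Ring A] [Algebra ℂ A] (φ : A →ₗ[ℂ] ℂ)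
    (S : ι → Subalgebra ℂ A) : Prop :=
  ∀ l : List (ι × A), l ≠ [] → l.IsChain (fun p q => p.1 ≠ q.1) →
    (∀ p ∈ l, p.2 ∈ S p.1 ∧ φ p.2 = 0) → φ (l.map Prod.snd).prod = 0

/-- Freeness of a family of selfadjoint noncommutative variables: the unital subalgebras which
they generate are free. (The subalgebra generated by a selfadjoint element is automatically
closed under `star`.) -/
def AreFree {A ι : Type*} [Ring A] [Algebra ℂ A] (φ : A →ₗ[ℂ] ℂ) (a : ι → A) : Prop :=
  AreFreeSubalgebras φ (fun i => Algebra.adjoin ℂ {a i})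

/-- `μ` is the law of the selfadjoint noncommutative variable `a`: the compactly supported
probability measure on `ℝ` which has the moments of `a`. -/
structure HasNCLaw {A : Type*} [Ring A] [Algebra ℂ A] (φ : A →ₗ[ℂ] ℂ) (a : A)
    (μ : Measure ℝ) : Prop where
  isProbabilityMeasure : IsProbabilityMeasure μ
  compact_support : ∃ K : Set ℝ, IsCompact K ∧ μ Kᶜ = 0
  moment_eq : ∀ k : ℕ, φ (a ^ k) = ((∫ x, x ^ k ∂μ : ℝ) : ℂ)

/-! ### Convolution powers -/

/-- The convolution power `μ ∗ ⋯ ∗ μ` (`n` factors). -/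
noncomputable def convPow (μ : Measure ℝ) : ℕ → Measure ℝ
  | 0 => Measure.dirac 0
  | n + 1 => (convPow μ n).conv μ

/-- `τ = μ ⊞ ν`, the free convolution: `τ` is the law of `a + b`, where `a` and `b` are free
selfadjoint variables with laws `μ` and `ν`. -/
def IsFreeConv (μ ν τ : Measure ℝ) : Prop :=
  ∃ (A : Type) (_ : Ring A) (_ : StarRing A) (_ : Algebra ℂ A) (_ : StarModule ℂ A)
    (φ : A →ₗ[ℂ] ℂ) (a b : A),
    IsNCState φ ∧ IsSelfAdjoint a ∧ IsSelfAdjoint b ∧ AreFree φ ![a, b] ∧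
    HasNCLaw φ a μ ∧ HasNCLaw φ b ν ∧ HasNCLaw φ (a + b) τ

/-- `τ = μ ⊞ ⋯ ⊞ μ` (`n` factors), the free convolution power. -/
def IsFreeConvPow (μ : Measure ℝ) : ℕ → Measure ℝ → Prop
  | 0, τ => τ = Measure.dirac 0
  | n + 1, τ => ∃ σ : Measure ℝ, IsFreeConvPow μ n σ ∧ IsFreeConv σ μ τ

/-! ### Compound Poisson and compound free Poisson laws -/

/-- The measure `(1 - c/n) δ₀ + (1/n) ρ`, where `c` is the mass of `ρ`. It is a probability measure
as soon as `n ≥ 1` and `n ≥ c`. -/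
noncomputable def poissonStep (ρ : Measure ℝ) (n : ℕ) : Measure ℝ :=
  ENNReal.ofReal (1 - ρ.real Set.univ / n) • Measure.dirac 0 + (n : ℝ≥0∞)⁻¹ • ρ

/-- `p = p_ρ`, the compound Poisson law: the weak limit of the convolution powers
`((1 - c/n) δ₀ + (1/n) ρ) ^ {∗ n}`. Only the large `n` matter. -/
def IsCompoundPoissonLaw (ρ : Measure ℝ) (p : ProbabilityMeasure ℝ) : Prop :=
  ∃ ν : ℕ → ProbabilityMeasure ℝ,
    (∀ᶠ n in atTop, (ν n : Measure ℝ) = convPow (poissonStep ρ n) n) ∧ Tendsto ν atTop (𝓝 p)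

/-- `π = π_ρ`, the compound free Poisson law: the weak limit of the free convolution powers
`((1 - c/n) δ₀ + (1/n) ρ) ^ {⊞ n}`. Only the large `n` matter. -/
def IsCompoundFreePoissonLaw (ρ : Measure ℝ) (π : ProbabilityMeasure ℝ) : Prop :=
  ∃ ν : ℕ → ProbabilityMeasure ℝ,
    (∀ᶠ n in atTop, IsFreeConvPow (poissonStep ρ n) n (ν n : Measure ℝ)) ∧
      Tendsto ν atTop (𝓝 π)

/-- `π` is the free Poisson law of parameter `c`: the weak limit of
`((1 - c/n) δ₀ + (c/n) δ₁) ^ {⊞ n}`. -/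
def IsFreePoissonLaw (c : ℝ≥0) (π : ProbabilityMeasure ℝ) : Prop :=
  IsCompoundFreePoissonLaw (c • Measure.dirac 1) π

/-- The discrete measure `∑ i, c i δ_{z i}`. -/
noncomputable def discreteMeasure {s : ℕ} (c : Fin s → ℝ≥0) (z : Fin s → ℝ) : Measure ℝ :=
  ∑ i, c i • Measure.dirac (z i)

/-! Both halves linearise convolution. Classically, one step has characteristic function 1 + f(t)/n
with f(t) = ∑ c_i (exp(i t z_i) - 1). Its n-th power tends to exp f, which is also the
characteristic function of ∑ z_i α_i for independent Poisson α_i.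

In the free half the R-transform replaces the logarithm. Voiculescu's relation G(R(t) + 1/t) = t
reads φ((1 + t R(t) - t a)⁻¹) = 1; expanded in t, it says that the polynomials `freeAppell R a n`
with n ≥ 1 are centred. Here `R n` is the cumulant of order n + 1. The relations are triangular, so
moments and cumulants determine each other. Cumulants add over free families
(`AreFree.map_freeAppell_sum`), because the resolvent of the sum expands into alternating centred
words. One step has moments of order 1/n, so n times its cumulants tend to the moments ∑ c_i
z_i^(k+1) of ρ (`tendsto_freeCumulant_of_small`).

Three analytic inputs turn this into measures. Free convolution powers exist, via free copies of a
matrix algebra on ℓ² of reduced words (`areFreeSubalgebras_matrixOp`) and a Riesz representation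
argument. The limiting cumulants belong to a compactly supported law, that of ∑ z_i (ℓ_i + √c_i)(ℓ_i
+ √c_i)* on the full Fock space. Convergence of moments to those of a compactly supported law gives
weak convergence (`tendsto_of_tendsto_moments`). Finally, additivity and homogeneity give ∑ z_i α_i
the same cumulants, hence the same moments, as the limit. -/

/-! ### Free cumulants -/

section FreeAppell

variable {A : Type*} [Ring A] [Algebra ℂ A]

/-- The polynomials in `a` with generating function `(1 + t R(t) - t a)⁻¹`, where
`R(t) = ∑ R n t ^ n`. -/
noncomputable def freeAppell (R : ℕ → ℂ) (a : A) : ℕ → A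
  | 0 => 1
  | n + 1 => a * freeAppell R a n - ∑ i : Fin (n + 1), R i • freeAppell R a (n - i)

@[simp]
lemma freeAppell_zero (R : ℕ → ℂ) (a : A) : freeAppell R a 0 = 1 := by
  rw [freeAppell]

lemma freeAppell_succ (R : ℕ → ℂ) (a : A) (n : ℕ) :
    freeAppell R a (n + 1) =
      a * freeAppell R a n - ∑ i ∈ Finset.range (n + 1), R i • freeAppell R a (n - i) := by
  rw [freeAppell, Finset.sum_range]

lemma map_freeAppell {B : Type*} [Ring B] [Algebra ℂ B] (f : A →ₐ[ℂ] B) (R : ℕ → ℂ) (a : A)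
    (n : ℕ) : f (freeAppell R a n) = freeAppell R (f a) n := by
  induction n using Nat.strong_induction_on with
  | _ n ih =>
    cases n with
    | zero => simp
    | succ n =>
      rw [freeAppell_succ, freeAppell_succ, map_sub, map_mul, map_sum, ih n (by omega)]
      congr 1
      refine Finset.sum_congr rfl fun i _ => ?_
      rw [map_smul, ih _ (by omega)]

lemma freeAppell_mem_adjoin (R : ℕ → ℂ) (a : A) (n : ℕ) :
    freeAppell R a n ∈ Algebra.adjoin ℂ {a} := by
  induction n using Nat.strong_induction_on with
  | _ n ih =>
    cases n with
    | zero => simp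
    | succ n =>
      rw [freeAppell_succ]
      refine Subalgebra.sub_mem _ (Subalgebra.mul_mem _
        (Algebra.self_mem_adjoin_singleton _ _) (ih n (by omega))) ?_
      exact Subalgebra.sum_mem _ fun i _ => Subalgebra.smul_mem _ (ih _ (by omega)) _

lemma freeAppell_congr {R R' : ℕ → ℂ} (a : A) {n : ℕ} (h : ∀ i < n, R i = R' i) :
    freeAppell R a n = freeAppell R' a n := by
  induction n using Nat.strong_induction_on with
  | _ n ih =>
    cases n with
    | zero => simp
    | succ n =>
      rw [freeAppell_succ, freeAppell_succ, ih n (by omega) fun i hi => h i (by omega)]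
      congr 1
      refine Finset.sum_congr rfl fun i hi => ?_
      rw [h i (Finset.mem_range.1 hi), ih _ (by omega) fun j hj => h j (by omega)]

lemma freeAppell_rescale (R : ℕ → ℂ) (a : A) (z : ℂ) (n : ℕ) :
    freeAppell (fun k => z ^ (k + 1) * R k) (z • a) n = z ^ n • freeAppell R a n := by
  induction n using Nat.strong_induction_on with
  | _ n ih =>
    cases n with
    | zero => simp
    | succ n =>
      rw [freeAppell_succ, freeAppell_succ, ih n (by omega), smul_sub, Finset.smul_sum]
      congr 1
      · rw [smul_mul_smul_comm, pow_succ']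
      · refine Finset.sum_congr rfl fun i hi => ?_
        rw [ih _ (by omega), smul_smul, smul_smul]
        have : n + 1 = (i + 1) + (n - i) := by
          have := Finset.mem_range.1 hi; omega
        rw [this, pow_add]
        ring_nf

/-- The recursion multiplies by `X` and subtracts terms of lower degree, so the polynomial stays
monic of degree `n`. This makes the moment-cumulant relations triangular. -/
lemma coeff_freeAppell_of_le (R : ℕ → ℂ) {n k : ℕ} (h : n ≤ k) :
    (freeAppell R (Polynomial.X : Polynomial ℂ) n).coeff k = if k = n then 1 else 0 := by
  induction n using Nat.strong_induction_on generalizing k with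
  | _ n ih =>
    cases n with
    | zero => simp [Polynomial.coeff_one]
    | succ n =>
      obtain ⟨k, rfl⟩ : ∃ j, k = j + 1 := ⟨k - 1, by omega⟩
      rw [freeAppell_succ, Polynomial.coeff_sub, Polynomial.coeff_X_mul, Polynomial.finsetSum_coeff,
        Finset.sum_eq_zero, ih n (by omega) (by omega)]
      · simp
      · intro i _
        rw [Polynomial.coeff_smul, ih _ (by omega) (by omega), if_neg (by omega), smul_zero]

lemma freeAppell_eq_sum (R : ℕ → ℂ) (a : A) {n N : ℕ} (h : n < N) :
    freeAppell R a n =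
      ∑ k ∈ Finset.range N, (freeAppell R (Polynomial.X : Polynomial ℂ) n).coeff k • a ^ k := by
  have h1 := map_freeAppell (Polynomial.aeval a) R (Polynomial.X : Polynomial ℂ) n
  rw [Polynomial.aeval_X] at h1
  rw [← h1, Polynomial.aeval_eq_sum_range']
  refine lt_of_le_of_lt (Polynomial.natDegree_le_iff_coeff_eq_zero.2 fun k hk => ?_) h
  rw [coeff_freeAppell_of_le R hk.le, if_neg (by omega)]

/-- Each coefficient is a polynomial expression in the first `n` cumulants, hence continuous in
them. -/
lemma tendsto_coeff_freeAppell {β : Type*} {l : Filter β} {R : β → ℕ → ℂ} {R' : ℕ → ℂ} {n : ℕ}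
    (h : ∀ i < n, Tendsto (fun b => R b i) l (𝓝 (R' i))) (k : ℕ) :
    Tendsto (fun b => (freeAppell (R b) (Polynomial.X : Polynomial ℂ) n).coeff k) l
      (𝓝 ((freeAppell R' (Polynomial.X : Polynomial ℂ) n).coeff k)) := by
  induction n using Nat.strong_induction_on generalizing k with
  | _ n ih =>
    cases n with
    | zero => simpa using tendsto_const_nhds
    | succ n =>
      simp only [freeAppell_succ, Polynomial.coeff_sub, Polynomial.finsetSum_coeff,
        Polynomial.coeff_smul, smul_eq_mul]
      refine Tendsto.sub ?_ (tendsto_finsetSum _ fun i hi => Tendsto.mul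
        (h i (Finset.mem_range.1 hi)) (ih _ (by omega) (fun j hj => h j (by omega)) k))
      cases k with
      | zero => simpa using tendsto_const_nhds
      | succ k =>
        simpa only [Polynomial.coeff_X_mul] using
          ih n (by omega) (fun j hj => h j (by omega)) k

end FreeAppell

/-! ### Moments and free cumulants determine each other -/

/-- `R` is the sequence of free cumulants (coefficients of the R-transform) of the
moment sequence `m`. -/
structure IsFreeCumulants (m R : ℕ → ℂ) : Prop where
  zero_eq : m 0 = 1
  sum_eq_zero : ∀ n, ∑ k ∈ Finset.range (n + 2),
    (freeAppell R (Polynomial.X : Polynomial ℂ) (n + 1)).coeff k * m k = 0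

section

variable {A : Type*} [Ring A] [Algebra ℂ A]

lemma map_freeAppell_eq_sum (φ : A →ₗ[ℂ] ℂ) (R : ℕ → ℂ) (a : A) {n N : ℕ} (h : n < N) :
    φ (freeAppell R a n) = ∑ k ∈ Finset.range N,
      (freeAppell R (Polynomial.X : Polynomial ℂ) n).coeff k * φ (a ^ k) := by
  rw [freeAppell_eq_sum R a h, map_sum]
  simp

lemma isFreeCumulants_iff {φ : A →ₗ[ℂ] ℂ} (h1 : φ 1 = 1) {a : A} {R : ℕ → ℂ} :
    IsFreeCumulants (fun k => φ (a ^ k)) R ↔ ∀ n, φ (freeAppell R a (n + 1)) = 0 := by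
  simp_rw [map_freeAppell_eq_sum φ R a (Nat.lt_succ_self _)]
  exact ⟨fun h => h.2, fun h => ⟨by simpa using h1, h⟩⟩

/-- The free cumulants determine the moments, continuously. -/
lemma IsFreeCumulants.tendsto {β : Type*} {l : Filter β} {m R : β → ℕ → ℂ} {m' R' : ℕ → ℂ}
    (h : ∀ᶠ b in l, IsFreeCumulants (m b) (R b)) (h' : IsFreeCumulants m' R')
    (hR : ∀ i, Tendsto (fun b => R b i) l (𝓝 (R' i))) (n : ℕ) :
    Tendsto (fun b => m b n) l (𝓝 (m' n)) := by
  -- Monicity lets the vanishing relation be solved for the top moment.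
  have key : ∀ {m R : ℕ → ℂ}, IsFreeCumulants m R → ∀ n, m (n + 1) =
      -∑ k ∈ Finset.range (n + 1),
        (freeAppell R (Polynomial.X : Polynomial ℂ) (n + 1)).coeff k * m k := by
    intro m R h n
    have := h.2 n
    rw [Finset.sum_range_succ, coeff_freeAppell_of_le R le_rfl, if_pos rfl, one_mul] at this
    exact eq_neg_of_add_eq_zero_right this
  induction n using Nat.strong_induction_on with
  | _ n ih =>
    cases n with
    | zero =>
      rw [h'.1]
      exact tendsto_const_nhds.congr' (h.mono fun b hb => hb.1.symm)
    | succ n =>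
      rw [key h' n]
      refine Tendsto.congr' (h.mono fun b hb => (key hb n).symm) ?_
      exact (tendsto_finsetSum _ fun k hk => (tendsto_coeff_freeAppell (fun i _ => hR i) k).mul
        (ih k (Finset.mem_range.1 hk))).neg

lemma IsFreeCumulants.unique {m m' R : ℕ → ℂ} (h : IsFreeCumulants m R)
    (h' : IsFreeCumulants m' R) : m = m' := by
  funext n
  have := IsFreeCumulants.tendsto (l := (atTop : Filter ℕ)) (m := fun _ => m) (R := fun _ => R)
    (Eventually.of_forall fun _ => h) h' (fun i => tendsto_const_nhds) n
  exact tendsto_nhds_unique tendsto_const_nhds this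

/-- The exponent is `k + 1` because `R k` is the cumulant of order k + 1. No division by `z` occurs,
so `z = 0` is allowed. -/
lemma IsFreeCumulants.rescale {m R : ℕ → ℂ} (h : IsFreeCumulants m R) (z : ℂ) :
    IsFreeCumulants (fun k => z ^ k * m k) (fun k => z ^ (k + 1) * R k) := by
  refine ⟨by simp [h.1], fun n => ?_⟩
  have h2 : ∀ k, (freeAppell (fun k => z ^ (k + 1) * R k) (Polynomial.X : Polynomial ℂ)
      (n + 1)).coeff k * z ^ k =
      z ^ (n + 1) * (freeAppell R (Polynomial.X : Polynomial ℂ) (n + 1)).coeff k := by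
    intro k
    have := freeAppell_rescale R (Polynomial.X : Polynomial ℂ) z (n + 1)
    have h3 := map_freeAppell (Polynomial.aeval (z • (Polynomial.X : Polynomial ℂ)))
      (fun k => z ^ (k + 1) * R k) (Polynomial.X : Polynomial ℂ) (n + 1)
    rw [Polynomial.aeval_X, this, Polynomial.smul_eq_C_mul, ← Polynomial.comp_eq_aeval] at h3
    have h4 := congrArg (fun p => Polynomial.coeff p k) h3
    simpa [Polynomial.comp_C_mul_X_coeff] using h4
  have := h.2 n
  simp_rw [← mul_assoc, h2, mul_assoc, ← Finset.mul_sum, this, mul_zero]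

/-- The sequence of free cumulants of a moment functional. -/
noncomputable def freeCumulant (m : ℕ → ℂ) : ℕ → ℂ
  | n => ∑ k ∈ Finset.range (n + 1), (freeAppell (fun i => if _h : i < n then freeCumulant m i else 0)
      (Polynomial.X : Polynomial ℂ) n).coeff k * m (k + 1)

/-- The truncation in the definition only makes the recursion well founded: the `n`-th polynomial
involves `R i` for `i < n` alone. -/
lemma freeCumulant_eq (m : ℕ → ℂ) (n : ℕ) :
    freeCumulant m n = ∑ k ∈ Finset.range (n + 1),
      (freeAppell (freeCumulant m) (Polynomial.X : Polynomial ℂ) n).coeff k * m (k + 1) := by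
  rw [freeCumulant]
  refine Finset.sum_congr rfl fun k _ => ?_
  congr 2
  exact freeAppell_congr _ fun i hi => by simp [hi]

/-- Apply the moment functional to A_{n+1} = X A_n - ∑ R_i A_{n-i}. By induction only i = n survives
in the sum, leaving φ(X A_n) - R_n, and R_n was chosen to be φ(X A_n). -/
lemma isFreeCumulants_freeCumulant {m : ℕ → ℂ} (hm : m 0 = 1) :
    IsFreeCumulants m (freeCumulant m) := by
  refine ⟨hm, fun n => ?_⟩
  set R := freeCumulant m
  induction n using Nat.strong_induction_on with
  | _ n ih =>
    have h0 : ∀ j, 0 < j → j < n + 1 → ∑ k ∈ Finset.range (n + 2),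
        (freeAppell R (Polynomial.X : Polynomial ℂ) j).coeff k * m k = 0 := by
      intro j hj hjn
      obtain ⟨j, rfl⟩ : ∃ i, j = i + 1 := ⟨j - 1, by omega⟩
      rw [← ih j (by omega)]
      refine (Finset.sum_subset (Finset.range_mono (by omega)) fun k _ hk => ?_).symm
      rw [Finset.mem_range, not_lt] at hk
      rw [coeff_freeAppell_of_le R (by omega), if_neg (by omega), zero_mul]
    simp only [freeAppell_succ, Polynomial.coeff_sub, Polynomial.finsetSum_coeff,
      Polynomial.coeff_smul, smul_eq_mul, sub_mul, Finset.sum_sub_distrib, Finset.sum_mul]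
    have h1 : ∑ k ∈ Finset.range (n + 2), (Polynomial.X * freeAppell R Polynomial.X n).coeff k * m k
        = R n := by
      rw [Finset.sum_range_succ']
      simp only [Polynomial.coeff_X_mul, Polynomial.coeff_X_mul_zero, zero_mul, add_zero]
      rw [← freeCumulant_eq]
    have h2 : ∑ k ∈ Finset.range (n + 2), ∑ i ∈ Finset.range (n + 1),
        R i * (freeAppell R (Polynomial.X : Polynomial ℂ) (n - i)).coeff k * m k = R n := by
      rw [Finset.sum_comm, Finset.sum_eq_single_of_mem n (by simp)]
      · rw [Nat.sub_self, freeAppell_zero, Finset.sum_eq_single_of_mem 0 (by simp)]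
        · simp [hm]
        · intro k _ hk
          simp [Polynomial.coeff_one, hk]
      · intro i hi hin
        have hi' := Finset.mem_range.1 hi
        simp_rw [mul_assoc, ← Finset.mul_sum]
        rw [h0 _ (by omega) (by omega), mul_zero]
    rw [h1, h2, sub_self]

/-- If the moments of order at least `1` are of size `ε`, then the free cumulants agree with the
moments to first order in `ε`. -/
lemma tendsto_freeCumulant_of_small {β : Type*} {l : Filter β} {ε : β → ℂ} {r : ℕ → ℂ}
    {m : β → ℕ → ℂ} (hε : Tendsto ε l (𝓝 0)) (hε0 : ∀ᶠ b in l, ε b ≠ 0)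
    (hm : ∀ᶠ b in l, ∀ k, m b (k + 1) = ε b * r (k + 1)) (n : ℕ) :
    Tendsto (fun b => (ε b)⁻¹ * freeCumulant (m b) n) l (𝓝 (r (n + 1))) := by
  induction n using Nat.strong_induction_on with
  | _ n ih =>
    -- The lower cumulants are O(ε), so the polynomial degenerates to X^n and only `r (n + 1)`
    -- survives.
    have h0 : ∀ i < n, Tendsto (fun b => freeCumulant (m b) i) l (𝓝 ((0 : ℕ → ℂ) i)) := by
      intro i hi
      have := hε.mul (ih i hi)
      rw [zero_mul] at this
      refine this.congr' (hε0.mono fun b hb => ?_)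
      field_simp
    have h1 : freeAppell (0 : ℕ → ℂ) (Polynomial.X : Polynomial ℂ) n = Polynomial.X ^ n := by
      clear ih h0
      induction n with
      | zero => simp
      | succ n ih => simp [freeAppell_succ, ih, pow_succ']
    have h2 : Tendsto (fun b => ∑ k ∈ Finset.range (n + 1),
        (freeAppell (freeCumulant (m b)) (Polynomial.X : Polynomial ℂ) n).coeff k * r (k + 1)) l
        (𝓝 (∑ k ∈ Finset.range (n + 1),
        (freeAppell 0 (Polynomial.X : Polynomial ℂ) n).coeff k * r (k + 1))) :=
      tendsto_finsetSum _ fun k _ => (tendsto_coeff_freeAppell h0 k).mul_const _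
    have h3 : ∑ k ∈ Finset.range (n + 1),
        (freeAppell 0 (Polynomial.X : Polynomial ℂ) n).coeff k * r (k + 1) = r (n + 1) := by
      simp [h1, Polynomial.coeff_X_pow]
    rw [h3] at h2
    refine h2.congr' ?_
    filter_upwards [hε0, hm] with b hb hmb
    rw [freeCumulant_eq, Finset.mul_sum]
    refine Finset.sum_congr rfl fun k _ => ?_
    rw [hmb]
    field_simp

lemma isFreeCumulants_zero : IsFreeCumulants (fun k => 0 ^ k) 0 := by
  have : IsFreeCumulants (fun k => LinearMap.id (R := ℂ) (M := ℂ) (0 ^ k)) 0 := by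
    rw [isFreeCumulants_iff rfl]
    intro n
    simp [freeAppell_succ]
  exact this

end

/-! ### Alternating words in centred elements -/

section Alternating

variable {A ι : Type*} [Ring A] [Algebra ℂ A]

/-- Nonempty alternating words of centred elements, with all indices in `T` and first index
in `I`. -/
structure IsAlternatingWord (φ : A →ₗ[ℂ] ℂ) (S : ι → Subalgebra ℂ A) (T I : Set ι)
    (l : List (ι × A)) : Prop where
  ne_nil : l ≠ []
  isChain : l.IsChain (fun p q => p.1 ≠ q.1)
  centred : ∀ p ∈ l, p.2 ∈ S p.1 ∧ φ p.2 = 0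
  index_mem : ∀ p ∈ l, p.1 ∈ T
  head_mem : ∀ p ∈ l.head?, p.1 ∈ I

/-- The span of the products of the alternating words. -/
def alternatingSpan (φ : A →ₗ[ℂ] ℂ) (S : ι → Subalgebra ℂ A) (T I : Set ι) : Submodule ℂ A :=
  Submodule.span ℂ ((fun l : List (ι × A) => (l.map Prod.snd).prod) ''
    {l | IsAlternatingWord φ S T I l})

variable {φ : A →ₗ[ℂ] ℂ} {S : ι → Subalgebra ℂ A} {T I : Set ι}

lemma IsAlternatingWord.prod_mem {l : List (ι × A)} (h : IsAlternatingWord φ S T I l) :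
    (l.map Prod.snd).prod ∈ alternatingSpan φ S T I :=
  Submodule.subset_span ⟨l, h, rfl⟩

lemma alternatingSpan_mono {T' I' : Set ι} (hT : T ⊆ T') (hI : I ⊆ I') :
    alternatingSpan φ S T I ≤ alternatingSpan φ S T' I' :=
  Submodule.span_mono (Set.image_mono fun _ hl => ⟨hl.ne_nil, hl.isChain, hl.centred,
    fun p hp => hT (hl.index_mem p hp), fun p hp => hI (hl.head_mem p hp)⟩)

lemma map_eq_zero_of_mem_alternatingSpan (hφ : AreFreeSubalgebras φ S) {x : A}
    (hx : x ∈ alternatingSpan φ S T I) : φ x = 0 := by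
  induction hx using Submodule.span_induction with
  | mem x hx =>
    obtain ⟨l, hl, rfl⟩ := hx
    exact hφ l hl.ne_nil hl.isChain hl.centred
  | zero => exact map_zero φ
  | add x y _ _ hx hy => rw [map_add, hx, hy, add_zero]
  | smul c x _ hx => rw [map_smul, hx, smul_zero]

/-- Only the junction needs care: the last index of `l` lies in `T` and the first index of `l'` in
`I'`. -/
lemma IsAlternatingWord.append {T' I' : Set ι} {l l' : List (ι × A)}
    (h : IsAlternatingWord φ S T I l) (h' : IsAlternatingWord φ S T' I' l')
    (hd : Disjoint T I') : IsAlternatingWord φ S (T ∪ T') I (l ++ l') where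
  ne_nil := by simp [h.ne_nil]
  isChain := List.isChain_append.2 ⟨h.isChain, h'.isChain, fun p hp q hq =>
    hd.ne_of_mem (h.index_mem p (List.mem_of_mem_getLast? hp)) (h'.head_mem q hq)⟩
  centred p hp := (List.mem_append.1 hp).elim (h.centred p) (h'.centred p)
  index_mem p hp := (List.mem_append.1 hp).imp (h.index_mem p) (h'.index_mem p)
  head_mem p hp := by
    rw [List.head?_append_of_ne_nil _ h.ne_nil] at hp
    exact h.head_mem p hp

lemma mul_mem_alternatingSpan {T' I' : Set ι} {x y : A} (hx : x ∈ alternatingSpan φ S T I)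
    (hy : y ∈ alternatingSpan φ S T' I') (hd : Disjoint T I') :
    x * y ∈ alternatingSpan φ S (T ∪ T') I := by
  induction hx, hy using Submodule.span_induction₂ with
  | mem_mem x y hx hy =>
    obtain ⟨l, hl, rfl⟩ := hx
    obtain ⟨l', hl', rfl⟩ := hy
    simpa using (hl.append hl' hd).prod_mem
  | zero_left y _ => simp
  | zero_right x _ => simp
  | add_left x y z _ _ _ h1 h2 => rw [add_mul]; exact add_mem h1 h2
  | add_right x y z _ _ _ h1 h2 => rw [mul_add]; exact add_mem h1 h2
  | smul_left r x y _ _ h => rw [smul_mul_assoc]; exact Submodule.smul_mem _ _ h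
  | smul_right r x y _ _ h => rw [mul_smul_comm]; exact Submodule.smul_mem _ _ h

lemma mem_alternatingSpan_of_centred {i : ι} {x : A} (hx : x ∈ S i) (hφx : φ x = 0) :
    x ∈ alternatingSpan φ S {i} {i} := by
  have : IsAlternatingWord φ S {i} {i} [(i, x)] := by
    constructor <;> simp_all
  simpa using this.prod_mem

lemma mul_mem_alternatingSpan_of_centred {i : ι} {x y : A} (hx : x ∈ S i) (hφx : φ x = 0)
    (hy : y ∈ alternatingSpan φ S T I) (hiT : i ∈ T) (hi : i ∉ I) :
    x * y ∈ alternatingSpan φ S T {i} := by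
  have := mul_mem_alternatingSpan (mem_alternatingSpan_of_centred hx hφx) hy
    (Set.disjoint_singleton_left.2 hi)
  rwa [Set.union_eq_self_of_subset_left (Set.singleton_subset_iff.2 hiT)] at this

/-- Scalars plus alternating words are stable under left multiplication by `S i`. If the word starts
with another index, split x into centred part plus scalar and prepend. If it starts with `i`, merge
x with the first letter and recentre; the tail left over is again alternating, or is 1. -/
lemma exists_sub_mem_alternatingSpan_mul (h1 : φ 1 = 1) {i : ι} (hi : i ∈ T) {x y : A}
    (hx : x ∈ S i) (hy : ∃ c : ℂ, y - c • 1 ∈ alternatingSpan φ S T T) :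
    ∃ c : ℂ, x * y - c • 1 ∈ alternatingSpan φ S T T := by
  have hcen : ∀ {x : A}, x ∈ S i → x - φ x • 1 ∈ S i ∧ φ (x - φ x • 1) = 0 := fun {x} hx =>
    ⟨Subalgebra.sub_mem _ hx (Subalgebra.smul_mem _ (Subalgebra.one_mem _) _), by simp [h1]⟩
  have hiT : ({i} : Set ι) ⊆ T := Set.singleton_subset_iff.2 hi
  have hsingle : x - φ x • 1 ∈ alternatingSpan φ S T T :=
    alternatingSpan_mono hiT hiT (mem_alternatingSpan_of_centred (hcen hx).1 (hcen hx).2)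
  suffices h : ∀ w ∈ alternatingSpan φ S T T,
      ∃ c : ℂ, x * w - c • 1 ∈ alternatingSpan φ S T T by
    obtain ⟨c, hc⟩ := hy
    obtain ⟨d, hd⟩ := h _ hc
    refine ⟨d + c * φ x, ?_⟩
    have : x * y - (d + c * φ x) • 1 = x * (y - c • 1) - d • 1 + c • (x - φ x • 1) := by
      simp only [mul_sub, mul_smul_comm, mul_one, add_smul, smul_sub, smul_smul]
      abel
    rw [this]
    exact add_mem hd (Submodule.smul_mem _ _ hsingle)
  intro w hw
  induction hw using Submodule.span_induction with
  | zero => exact ⟨0, by simp⟩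
  | add v w _ _ hv hw =>
    obtain ⟨c, hc⟩ := hv
    obtain ⟨d, hd⟩ := hw
    refine ⟨c + d, ?_⟩
    have : x * (v + w) - (c + d) • 1 = (x * v - c • 1) + (x * w - d • 1) := by
      rw [mul_add, add_smul]; abel
    rw [this]
    exact add_mem hc hd
  | smul r w _ hw =>
    obtain ⟨c, hc⟩ := hw
    refine ⟨r * c, ?_⟩
    rw [mul_smul_comm, mul_smul, ← smul_sub]
    exact Submodule.smul_mem _ _ hc
  | mem w hw =>
    obtain ⟨l, hl, rfl⟩ := hw
    obtain ⟨⟨j, y⟩, l, rfl⟩ := List.exists_cons_of_ne_nil hl.ne_nil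
    by_cases hij : j = i
    · subst hij
      have hxy : x * y ∈ S j := Subalgebra.mul_mem _ hx (hl.centred (j, y) (by simp)).1
      have h2 : (x * y - φ (x * y) • 1) * (l.map Prod.snd).prod ∈ alternatingSpan φ S T T := by
        have : IsAlternatingWord φ S T T ((j, x * y - φ (x * y) • 1) :: l) := by
          refine ⟨by simp, ?_, ?_, ?_, ?_⟩
          · have := hl.isChain
            rw [List.isChain_cons] at this ⊢
            exact this
          · intro p hp
            rcases List.mem_cons.1 hp with rfl | hp
            · exact hcen hxy
            · exact hl.centred p (List.mem_cons_of_mem _ hp)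
          · intro p hp
            rcases List.mem_cons.1 hp with rfl | hp
            · exact hi
            · exact hl.index_mem p (List.mem_cons_of_mem _ hp)
          · simpa using hi
        simpa using this.prod_mem
      obtain ⟨c, hc⟩ : ∃ c : ℂ, (l.map Prod.snd).prod - c • 1 ∈ alternatingSpan φ S T T := by
        by_cases hnil : l = []
        · exact ⟨1, by simp [hnil]⟩
        · refine ⟨0, ?_⟩
          have : IsAlternatingWord φ S T T l :=
            ⟨hnil, (List.isChain_cons.1 hl.isChain).2,
              fun p hp => hl.centred p (List.mem_cons_of_mem _ hp),
              fun p hp => hl.index_mem p (List.mem_cons_of_mem _ hp),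
              fun p hp => hl.index_mem p (List.mem_cons_of_mem _ (List.mem_of_mem_head? hp))⟩
          simpa using this.prod_mem
      refine ⟨φ (x * y) * c, ?_⟩
      have : x * ((((j, y) :: l).map Prod.snd).prod) - (φ (x * y) * c) • 1 =
          (x * y - φ (x * y) • 1) * (l.map Prod.snd).prod +
            φ (x * y) • ((l.map Prod.snd).prod - c • 1) := by
        simp only [List.map_cons, List.prod_cons, sub_mul, smul_mul_assoc, one_mul, smul_sub,
          smul_smul, mul_assoc]
        abel
      rw [this]
      exact add_mem h2 (Submodule.smul_mem _ _ hc)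
    · have hl' : IsAlternatingWord φ S T {j} ((j, y) :: l) :=
        ⟨hl.ne_nil, hl.isChain, hl.centred, hl.index_mem, by simp⟩
      have h2 := alternatingSpan_mono subset_rfl hiT (mul_mem_alternatingSpan_of_centred
        (hcen hx).1 (hcen hx).2 hl'.prod_mem hi (by simpa using Ne.symm hij))
      refine ⟨0, ?_⟩
      have h3 := add_mem h2 (Submodule.smul_mem _ (φ x) hl.prod_mem)
      rw [sub_mul, smul_mul_assoc, one_mul, sub_add_cancel] at h3
      simpa using h3

/-- Left multiplication by each generator preserves scalars plus alternating words, hence so does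
that by `y`. Applied to 1, this expands `y`, and the scalar part is φ y = 0. -/
lemma mem_alternatingSpan_of_mem_adjoin {x : ι → A} (h1 : φ 1 = 1) (hx : AreFree φ x) {y : A}
    (hy : y ∈ Algebra.adjoin ℂ (x '' T)) (hφy : φ y = 0) :
    y ∈ alternatingSpan φ (fun i => Algebra.adjoin ℂ {x i}) T T := by
  suffices h : ∀ w : A, (∃ c : ℂ, w - c • 1 ∈
      alternatingSpan φ (fun i => Algebra.adjoin ℂ {x i}) T T) → ∃ c : ℂ, y * w - c • 1 ∈
      alternatingSpan φ (fun i => Algebra.adjoin ℂ {x i}) T T by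
    obtain ⟨c, hc⟩ := h 1 ⟨1, by simp⟩
    rw [mul_one] at hc
    have := map_eq_zero_of_mem_alternatingSpan hx hc
    have hc0 : c = 0 := by simpa [hφy, h1] using this
    simpa [hc0] using hc
  clear hφy
  induction hy using Algebra.adjoin_induction with
  | mem y hy =>
    obtain ⟨i, hi, rfl⟩ := hy
    exact fun w hw => exists_sub_mem_alternatingSpan_mul h1 hi
      (Algebra.self_mem_adjoin_singleton _ _) hw
  | algebraMap r =>
    rintro w ⟨c, hc⟩
    refine ⟨r * c, ?_⟩
    rw [Algebra.algebraMap_eq_smul_one, smul_mul_assoc, one_mul, mul_smul, ← smul_sub]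
    exact Submodule.smul_mem _ _ hc
  | add u v _ _ hu hv =>
    intro w hw
    obtain ⟨c, hc⟩ := hu w hw
    obtain ⟨d, hd⟩ := hv w hw
    refine ⟨c + d, ?_⟩
    have : (u + v) * w - (c + d) • 1 = (u * w - c • 1) + (v * w - d • 1) := by
      rw [add_mul, add_smul]; abel
    rw [this]
    exact add_mem hc hd
  | mul u v _ _ hu hv =>
    intro w hw
    rw [mul_assoc]
    exact hu _ (hv w hw)

/-- Elements of the subalgebras generated by disjoint blocks of a free family are free. -/
theorem AreFree.of_mem_adjoin {κ : Type*} {x : ι → A} (h1 : φ 1 = 1) (hx : AreFree φ x)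
    {T : κ → Set ι} (hT : Pairwise (Function.onFun Disjoint T)) {b : κ → A}
    (hb : ∀ k, b k ∈ Algebra.adjoin ℂ (x '' T k)) : AreFree φ b := by
  have hsub : ∀ k, Algebra.adjoin ℂ {b k} ≤ Algebra.adjoin ℂ (x '' T k) := fun k =>
    Algebra.adjoin_le (Set.singleton_subset_iff.2 (hb k))
  -- Each centred factor expands into alternating words with indices in its own block; disjointness
  -- of neighbouring blocks lets these be concatenated.
  have key : ∀ l : List (κ × A), l.IsChain (fun p q => p.1 ≠ q.1) →
      (∀ p ∈ l, p.2 ∈ Algebra.adjoin ℂ {b p.1} ∧ φ p.2 = 0) → ∀ p ∈ l.head?,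
      (l.map Prod.snd).prod ∈
        alternatingSpan φ (fun i => Algebra.adjoin ℂ {x i}) Set.univ (T p.1) := by
    intro l
    induction l with
    | nil => simp
    | cons p l ih =>
      intro hch hcen q hq
      obtain rfl : p = q := by simpa using hq
      have hp := mem_alternatingSpan_of_mem_adjoin h1 hx (hsub p.1 (hcen p (by simp)).1)
        (hcen p (by simp)).2
      rw [List.isChain_cons] at hch
      cases l with
      | nil => simpa using alternatingSpan_mono (Set.subset_univ _) subset_rfl hp
      | cons q l =>
        have h2 := ih hch.2 (fun r hr => hcen r (List.mem_cons_of_mem _ hr)) q (by simp)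
        have h3 := mul_mem_alternatingSpan hp h2 (hT (hch.1 q (by simp)))
        simpa using h3
  intro l hl hch hcen
  obtain ⟨p, l, rfl⟩ := List.exists_cons_of_ne_nil hl
  exact map_eq_zero_of_mem_alternatingSpan hx (key _ hch hcen p (by simp))

end Alternating

/-! ### Additivity of free cumulants -/

section Additivity

variable {A : Type*} [Ring A] [Algebra ℂ A]

open PowerSeries in
/-- The series `1 + t R(t) - t a`. -/
noncomputable def resolventSeries (R : ℕ → ℂ) (a : A) : PowerSeries A :=
  1 + X * PowerSeries.mk (fun n => algebraMap ℂ A (R n)) - X * C a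

open PowerSeries in
/-- The generating function of the sequence `freeAppell R a`. -/
noncomputable def freeAppellSeries (R : ℕ → ℂ) (a : A) : PowerSeries A :=
  PowerSeries.mk (freeAppell R a)

lemma resolventSeries_mul (R : ℕ → ℂ) (a : A) :
    resolventSeries R a * freeAppellSeries R a = 1 := by
  ext n
  rw [resolventSeries, sub_mul, add_mul, one_mul, mul_assoc, mul_assoc]
  cases n with
  | zero => simp [freeAppellSeries]
  | succ n =>
    rw [map_sub, map_add, PowerSeries.coeff_succ_X_mul, PowerSeries.coeff_succ_X_mul,
      PowerSeries.coeff_C_mul, PowerSeries.coeff_mul,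
      Finset.Nat.sum_antidiagonal_eq_sum_range_succ_mk]
    simp only [freeAppellSeries, PowerSeries.coeff_mk, freeAppell_succ, Algebra.smul_def,
      PowerSeries.coeff_one, Nat.succ_ne_zero, if_false]
    abel

/-- The constant coefficient is 1, so a left inverse exists, and it agrees with the right inverse.
-/
lemma mul_resolventSeries (R : ℕ → ℂ) (a : A) :
    freeAppellSeries R a * resolventSeries R a = 1 := by
  have h : PowerSeries.constantCoeff (resolventSeries R a) = ((1 : Aˣ) : A) := by
    simp [resolventSeries]
  have h1 := PowerSeries.invOfUnit_mul _ _ h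
  have h2 : PowerSeries.invOfUnit (resolventSeries R a) 1 = freeAppellSeries R a := by
    rw [← mul_one (PowerSeries.invOfUnit _ _), ← resolventSeries_mul R a, ← mul_assoc, h1, one_mul]
  rw [← h2, h1]

/-- The free cumulants of the sum of a free family are the sums of the free cumulants. -/
theorem AreFree.map_freeAppell_sum {ι : Type*} [Fintype ι] {φ : A →ₗ[ℂ] ℂ} {a : ι → A}
    (ha : AreFree φ a) {R : ι → ℕ → ℂ} (hR : ∀ i n, φ (freeAppell (R i) (a i) (n + 1)) = 0)
    (n : ℕ) : φ (freeAppell (∑ i, R i) (∑ i, a i) (n + 1)) = 0 := by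
  classical
  -- Put u_i = 1 - `resolventSeries (R i) (a i)`. Then W = (1 - ∑ u_i)⁻¹ and V_i = u_i W, so W = 1 +
  -- ∑ V_i.
  set W : PowerSeries A := freeAppellSeries (∑ i, R i) (∑ i, a i) with hW
  set V : ι → PowerSeries A := fun i => (1 - resolventSeries (R i) (a i)) * W with hV
  have hsum : ∑ i, V i = W - 1 := by
    have h1 : ∑ i, (1 - resolventSeries (R i) (a i)) =
        1 - resolventSeries (∑ i, R i) (∑ i, a i) := by
      have h2 : PowerSeries.mk (fun n => algebraMap ℂ A ((∑ i, R i) n)) =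
          ∑ i, PowerSeries.mk (fun n => algebraMap ℂ A (R i n)) := by
        ext n; simp [Finset.sum_apply]
      simp only [resolventSeries, h2, map_sum, Finset.mul_sum]
      rw [add_sub_assoc, sub_add_cancel_left, neg_sub, ← Finset.sum_sub_distrib]
      exact Finset.sum_congr rfl fun i _ => by abel
    rw [hV, ← Finset.sum_mul, h1, sub_mul, one_mul, resolventSeries_mul]
  -- From (1 - u_i) W = 1 + ∑_{j ≠ i} V_j and u_i = ((1 - u_i)⁻¹ - 1)(1 - u_i).
  have hrec : ∀ i, V i = (freeAppellSeries (R i) (a i) - 1) *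
      (1 + ∑ j ∈ Finset.univ.erase i, V j) := by
    intro i
    have h1 : 1 + ∑ j ∈ Finset.univ.erase i, V j = resolventSeries (R i) (a i) * W := by
      have h2 := Finset.add_sum_erase Finset.univ V (Finset.mem_univ i)
      rw [hsum] at h2
      have h3 : 1 + ∑ j ∈ Finset.univ.erase i, V j = W - V i := by
        rw [eq_sub_iff_add_eq, add_assoc, add_comm _ (V i), h2]; abel
      rw [h3, hV]
      simp only [sub_mul, one_mul]
      abel
    rw [h1, ← mul_assoc, sub_mul, mul_resolventSeries, one_mul]
  -- The first factor in `hrec` has centred coefficients and no constant term, so induction on the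
  -- degree builds words that start with `i`.
  have hmem : ∀ n i, PowerSeries.coeff n (V i) ∈
      alternatingSpan φ (fun i => Algebra.adjoin ℂ {a i}) Set.univ {i} := by
    intro n
    induction n using Nat.strong_induction_on with
    | _ n ih =>
      intro i
      rw [hrec i, PowerSeries.coeff_mul]
      refine Submodule.sum_mem _ fun p hp => ?_
      rw [Finset.HasAntidiagonal.mem_antidiagonal] at hp
      rcases hp1 : p.1 with _ | k
      · simp [freeAppellSeries]
      have hx : PowerSeries.coeff (k + 1) (freeAppellSeries (R i) (a i) - 1) =
          freeAppell (R i) (a i) (k + 1) := by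
        simp [freeAppellSeries, PowerSeries.coeff_one]
      have hxm := freeAppell_mem_adjoin (R i) (a i) (k + 1)
      rw [hx, map_add, mul_add]
      refine add_mem ?_ ?_
      · rw [PowerSeries.coeff_one]
        split_ifs
        · rw [mul_one]
          exact alternatingSpan_mono (Set.subset_univ _) subset_rfl
            (mem_alternatingSpan_of_centred hxm (hR i k))
        · simp
      · rw [map_sum, Finset.mul_sum]
        refine Submodule.sum_mem _ fun j hj => ?_
        exact mul_mem_alternatingSpan_of_centred hxm (hR i k) (ih p.2 (by omega) j)
          (Set.mem_univ _) (by simpa using (Finset.ne_of_mem_erase hj).symm)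
  have hfin : freeAppell (∑ i, R i) (∑ i, a i) (n + 1) = ∑ i, PowerSeries.coeff (n + 1) (V i) := by
    rw [← map_sum, hsum]
    simp [hW, freeAppellSeries, PowerSeries.coeff_one]
  rw [hfin, map_sum]
  exact Finset.sum_eq_zero fun i _ => map_eq_zero_of_mem_alternatingSpan ha (hmem _ i)

theorem AreFree.isFreeCumulants_sum {ι : Type*} [Fintype ι] {φ : A →ₗ[ℂ] ℂ} (h1 : φ 1 = 1)
    {a : ι → A} (ha : AreFree φ a) {R : ι → ℕ → ℂ}
    (hR : ∀ i, IsFreeCumulants (fun k => φ (a i ^ k)) (R i)) :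
    IsFreeCumulants (fun k => φ ((∑ i, a i) ^ k)) (∑ i, R i) :=
  (isFreeCumulants_iff h1).2 (ha.map_freeAppell_sum fun i => (isFreeCumulants_iff h1).1 (hR i))

end Additivity

/-! ### The law of a bounded selfadjoint operator -/

section VectorState

variable {H : Type*} [NormedAddCommGroup H] [InnerProductSpace ℂ H]

/-- The functional `T ↦ ⟪Ω, T Ω⟫`. -/
noncomputable def vectorState (Ω : H) : (H →L[ℂ] H) →ₗ[ℂ] ℂ where
  toFun T := inner ℂ Ω (T Ω)
  map_add' S T := by simp
  map_smul' c T := by simp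

@[simp]
lemma vectorState_apply (Ω : H) (T : H →L[ℂ] H) : vectorState Ω T = inner ℂ Ω (T Ω) := rfl

variable [CompleteSpace H]

lemma vectorState_star_mul_self (Ω : H) (T : H →L[ℂ] H) :
    vectorState Ω (star T * T) = ((‖T Ω‖ ^ 2 : ℝ) : ℂ) := by
  rw [vectorState_apply, ContinuousLinearMap.star_eq_adjoint, mul_apply_eq_comp,
    ContinuousLinearMap.adjoint_inner_right, inner_self_eq_norm_sq_to_K]
  norm_cast

lemma isNCState_vectorState {Ω : H} (hΩ : ‖Ω‖ = 1) : IsNCState (vectorState Ω) where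
  map_one := by simp [inner_self_eq_norm_sq_to_K, hΩ]
  re_nonneg T := by rw [vectorState_star_mul_self, Complex.ofReal_re]; positivity
  im_eq_zero T := by rw [vectorState_star_mul_self, Complex.ofReal_im]

open scoped CompactlySupported in
/-- Every bounded selfadjoint operator has a law with respect to a vector state. -/
theorem exists_hasNCLaw_vectorState {Ω : H} (hΩ : ‖Ω‖ = 1) {T : H →L[ℂ] H}
    (hT : IsSelfAdjoint T) : ∃ μ : Measure ℝ, HasNCLaw (vectorState Ω) T μ := by
  have hcpt : CompactSpace (spectrum ℝ T) :=
    isCompact_iff_compactSpace.1 (ContinuousFunctionalCalculus.isCompact_spectrum T)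
  let F : C(spectrum ℝ T, ℝ) →⋆ₐ[ℝ] (H →L[ℂ] H) := cfcHom hT
  let L : C_c(spectrum ℝ T, ℝ) →ₗ[ℝ] ℝ :=
    { toFun f := (vectorState Ω (F f.toContinuousMap)).re
      map_add' f g := by
        have : (f + g).toContinuousMap = f.toContinuousMap + g.toContinuousMap := rfl
        rw [this, map_add, map_add, Complex.add_re]
      map_smul' c f := by
        have : (c • f).toContinuousMap = c • f.toContinuousMap := rfl
        rw [this, map_smul]
        simp }
  have hL : ∀ f : C_c(spectrum ℝ T, ℝ), 0 ≤ f → 0 ≤ L f := by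
    intro f hf
    have hf' : ∀ x, 0 ≤ f x := hf
    -- A nonnegative f is g* g with g = √f, so the functional takes a squared norm as its value.
    let g : C(spectrum ℝ T, ℝ) := ⟨fun x => Real.sqrt (f x), by fun_prop⟩
    have hg : f.toContinuousMap = star g * g := by
      ext x
      simp [g, Real.mul_self_sqrt (hf' x)]
    change 0 ≤ (vectorState Ω (F f.toContinuousMap)).re
    rw [hg, map_mul, map_star, vectorState_star_mul_self, Complex.ofReal_re]
    positivity
  let Λ : C_c(spectrum ℝ T, ℝ) →ₚ[ℝ] ℝ := PositiveLinearMap.mk₀ L hL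
  let ν := RealRMK.rieszMeasure Λ
  have hmom : ∀ k : ℕ, ∫ x, (x : ℝ) ^ k ∂ν = (vectorState Ω (T ^ k)).re := by
    intro k
    let p : C(spectrum ℝ T, ℝ) := (ContinuousMap.restrict (spectrum ℝ T) (ContinuousMap.id ℝ)) ^ k
    have h := RealRMK.integral_rieszMeasure Λ (CompactlySupportedContinuousMap.continuousMapEquiv p)
    have h2 : F p = T ^ k := by
      rw [map_pow]
      congr 1
      exact cfcHom_id hT
    rw [← h2]
    exact h
  have hprob : IsProbabilityMeasure ν := by
    have h := hmom 0
    simp only [pow_zero, integral_const, smul_eq_mul, mul_one, vectorState_apply,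
      one_apply_eq_self] at h
    rw [inner_self_eq_norm_sq_to_K, hΩ] at h
    refine ⟨?_⟩
    have h3 : (ν Set.univ).toReal = 1 := by simpa [Measure.real] using h
    rwa [ENNReal.toReal_eq_one_iff] at h3
  refine ⟨ν.map Subtype.val, ?_, ⟨spectrum ℝ T,
    ContinuousFunctionalCalculus.isCompact_spectrum T, ?_⟩, fun k => ?_⟩
  · exact Measure.isProbabilityMeasure_map measurable_subtype_coe.aemeasurable
  · have hm : MeasurableSet (spectrum ℝ T) :=
      (ContinuousFunctionalCalculus.isCompact_spectrum T).measurableSet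
    rw [Measure.map_apply measurable_subtype_coe hm.compl]
    convert measure_empty (μ := ν)
    ext x
    simp
  · rw [integral_map measurable_subtype_coe.aemeasurable (by fun_prop), hmom]
    have hk : IsSelfAdjoint (T ^ k) := hT.pow k
    apply Complex.ext
    · simp
    · rw [Complex.ofReal_im, vectorState_apply]
      generalize T ^ k = S at hk
      exact hk.isSymmetric.im_inner_self_apply Ω

end VectorState

/-! ### Partial permutation operators on `ℓ²` -/

section PEquivOp

variable {W : Type*}

/-- A partial permutation is injective where defined, and elsewhere the summand is 0. This is what
bounds the operator by 1. -/
lemma exists_sum_elim_pequiv_eq (g : W ≃. W) {F : W → ℝ} (s : Finset W) :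
    ∃ t : Finset W, ∑ v ∈ s, (g v).elim 0 F = ∑ w ∈ t, F w := by
  classical
  refine ⟨(s.filter fun v => (g v).isSome).image fun v => (g v).getD v, ?_⟩
  rw [Finset.sum_image, Finset.sum_filter]
  · refine Finset.sum_congr rfl fun v _ => ?_
    cases h : g v <;> simp
  · intro v hv w hw hvw
    obtain ⟨a, ha⟩ := Option.isSome_iff_exists.1 (Finset.mem_filter.1 hv).2
    obtain ⟨b, hb⟩ := Option.isSome_iff_exists.1 (Finset.mem_filter.1 hw).2
    simp only [ha, hb, Option.getD_some] at hvw
    subst hvw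
    exact g.inj ha hb

lemma sum_norm_elim_le (g : W ≃. W) (f : lp (fun _ : W => ℂ) 2) (s : Finset W) :
    ∑ v ∈ s, ‖(g v).elim 0 f‖ ^ (2 : ℝ≥0∞).toReal ≤ ‖f‖ ^ (2 : ℝ≥0∞).toReal := by
  obtain ⟨t, ht⟩ := exists_sum_elim_pequiv_eq g (F := fun w => ‖f w‖ ^ (2 : ℝ≥0∞).toReal) s
  have : ∑ v ∈ s, ‖(g v).elim 0 f‖ ^ (2 : ℝ≥0∞).toReal =
      ∑ v ∈ s, (g v).elim 0 (fun w => ‖f w‖ ^ (2 : ℝ≥0∞).toReal) := by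
    refine Finset.sum_congr rfl fun v _ => ?_
    cases g v <;> simp
  rw [this, ht]
  exact lp.sum_rpow_le_norm_rpow (by simp) f t

/-- The partial isometry of `ℓ²(W)` given by a partial permutation of `W`. -/
noncomputable def pequivOp (g : W ≃. W) :
    lp (fun _ : W => ℂ) 2 →L[ℂ] lp (fun _ : W => ℂ) 2 :=
  LinearMap.mkContinuous
    { toFun f := ⟨fun v => (g v).elim 0 f, memℓp_gen' (sum_norm_elim_le g f)⟩
      map_add' f h := by
        ext v
        change (g v).elim 0 (⇑f + ⇑h) = (g v).elim 0 f + (g v).elim 0 h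
        cases g v <;> simp
      map_smul' c f := by
        ext v
        change (g v).elim 0 (c • ⇑f) = c • (g v).elim 0 f
        cases g v <;> simp } 1
    fun f => by
      rw [one_mul]
      exact lp.norm_le_of_forall_sum_le (by simp) (norm_nonneg f) (sum_norm_elim_le g f)

@[simp]
lemma pequivOp_apply (g : W ≃. W) (f : lp (fun _ : W => ℂ) 2) (v : W) :
    pequivOp g f v = (g v).elim 0 f := rfl

lemma star_pequivOp (g : W ≃. W) : star (pequivOp g) = pequivOp g.symm := by
  rw [ContinuousLinearMap.star_eq_adjoint, eq_comm, ContinuousLinearMap.eq_adjoint_iff]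
  intro x y
  rw [lp.inner_eq_tsum, lp.inner_eq_tsum]
  simp only [pequivOp_apply]
  have hsome : ∀ w : Function.support fun w => inner ℂ (x w) ((g w).elim 0 y),
      (g w).isSome := by
    rintro ⟨w, hw⟩
    by_contra h
    simp only [Option.not_isSome_iff_eq_none] at h
    simp [h] at hw
  refine tsum_eq_tsum_of_ne_zero_bij (fun w => (g w).get (hsome w)) ?_ ?_ ?_
  · rintro ⟨v, hv⟩ ⟨w, hw⟩ h
    obtain ⟨a, ha⟩ := Option.isSome_iff_exists.1 (hsome ⟨v, hv⟩)
    obtain ⟨b, hb⟩ := Option.isSome_iff_exists.1 (hsome ⟨w, hw⟩)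
    simp only at ha hb
    simp only [ha, hb, Option.get_some] at h
    subst h
    exact Subtype.ext (g.inj ha hb)
  · intro v hv
    cases h : g.symm v with
    | none => simp [h] at hv
    | some w =>
      have h2 : g w = some v := g.eq_some_iff.1 h
      refine ⟨⟨w, ?_⟩, by simp [h2]⟩
      simpa [h, h2] using hv
  · rintro ⟨w, hw⟩
    obtain ⟨a, ha⟩ := Option.isSome_iff_exists.1 (hsome ⟨w, hw⟩)
    simp only at ha
    have h2 : g.symm a = some w := g.eq_some_iff.2 ha
    simp [ha, h2]

end PEquivOp

/-! ### Matrices acting on a tensor factor of `ℓ²` -/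

section MatrixOp

variable {W G Y : Type*} [Fintype G] [DecidableEq G]

/-- The partial permutation which replaces the first coordinate `j` by `k`. -/
def Equiv.replaceFst (e : W ≃ G × Y) (j k : G) : W ≃. W where
  toFun v := if (e v).1 = j then some (e.symm (k, (e v).2)) else none
  invFun v := if (e v).1 = k then some (e.symm (j, (e v).2)) else none
  inv a b := by
    by_cases ha : (e a).1 = j <;> by_cases hb : (e b).1 = k
    · simp only [ha, hb, if_true, Option.some.injEq, Equiv.symm_apply_eq,
        Prod.ext_iff]
      grind
    · simp only [ha, hb, if_true, if_false, reduceCtorEq, Option.some.injEq,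
        Equiv.symm_apply_eq, Prod.ext_iff]
      grind
    · simp only [ha, hb, if_true, if_false, reduceCtorEq, Option.some.injEq,
        Equiv.symm_apply_eq, Prod.ext_iff]
      grind
    · simp [ha, hb]

/-- A matrix acting on the first factor of `ℓ²(W) = ℓ²(G) ⊗ ℓ²(Y)`. -/
noncomputable def matrixOp (e : W ≃ G × Y) (T : Matrix G G ℂ) :
    lp (fun _ : W => ℂ) 2 →L[ℂ] lp (fun _ : W => ℂ) 2 :=
  ∑ j, ∑ k, T j k • pequivOp (e.replaceFst j k)

lemma matrixOp_apply (e : W ≃ G × Y) (T : Matrix G G ℂ) (f : lp (fun _ : W => ℂ) 2) (v : W) :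
    matrixOp e T f v = ∑ k, T (e v).1 k * f (e.symm (k, (e v).2)) := by
  have h : ∀ j k, (T j k • pequivOp (e.replaceFst j k)) f v =
      if (e v).1 = j then T j k * f (e.symm (k, (e v).2)) else 0 := by
    intro j k
    change T j k * ((e.replaceFst j k) v).elim 0 f = _
    change T j k * Option.elim (if (e v).1 = j then some (e.symm (k, (e v).2)) else none) 0 f = _
    split_ifs <;> simp
  have h2 : matrixOp e T f v = ∑ j, ∑ k, (T j k • pequivOp (e.replaceFst j k)) f v := by
    simp only [matrixOp, sum_apply, lp.coeFn_sum, Finset.sum_apply]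
  rw [h2, Finset.sum_comm]
  simp only [h, Finset.sum_ite_eq, Finset.mem_univ, if_true]

lemma star_matrixOp (e : W ≃ G × Y) (T : Matrix G G ℂ) :
    star (matrixOp e T) = matrixOp e (star T) := by
  simp only [matrixOp, star_sum, star_smul, star_pequivOp, Matrix.star_apply]
  rw [Finset.sum_comm]
  rfl

/-- The action of matrices on the first factor of `ℓ²(G) ⊗ ℓ²(Y)`, as an algebra morphism. -/
noncomputable def matrixOpHom (e : W ≃ G × Y) :
    Matrix G G ℂ →ₐ[ℂ] (lp (fun _ : W => ℂ) 2 →L[ℂ] lp (fun _ : W => ℂ) 2) :=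
  AlgHom.ofLinearMap
    { toFun := matrixOp e
      map_add' S T := by
        simp [matrixOp, add_smul, Finset.sum_add_distrib]
      map_smul' c T := by
        simp [matrixOp, Finset.smul_sum, mul_smul] }
    (by
      ext f v
      change matrixOp e 1 f v = f v
      simp [matrixOp_apply, Matrix.one_apply])
    (by
      intro S T
      ext f v
      change matrixOp e (S * T) f v = matrixOp e S (matrixOp e T f) v
      simp only [matrixOp_apply, Matrix.mul_apply, Finset.sum_mul, Finset.mul_sum,
        Equiv.apply_symm_apply]
      rw [Finset.sum_comm]
      simp only [mul_assoc])

@[simp]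
lemma matrixOpHom_apply (e : W ≃ G × Y) (T : Matrix G G ℂ) : matrixOpHom e T = matrixOp e T := rfl

end MatrixOp

/-! ### The free product of copies of a matrix algebra -/

section FreeProduct

open Monoid.CoprodI

variable {ι G : Type*} [DecidableEq ι] [DecidableEq G] [Monoid G]

/-- A reduced word is a letter of index `i` (possibly `1`) followed by a word which does not start
with the index `i`. -/
def wordEquiv (i : ι) :
    Word (fun _ : ι => G) ≃ G × {w : Word (fun _ : ι => G) // w.fstIdx ≠ some i} :=
  (Word.equivPair i).trans
    { toFun p := (p.head, ⟨p.tail, p.fstIdx_ne⟩)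
      invFun p := ⟨p.1, p.2.1, p.2.2⟩ }

lemma wordEquiv_of_fstIdx_ne {i : ι} {w : Word (fun _ : ι => G)} (h : w.fstIdx ≠ some i) :
    wordEquiv i w = (1, ⟨w, h⟩) := by
  simp [wordEquiv, Word.equivPair_eq_of_fstIdx_ne h]

lemma fstIdx_wordEquiv_symm {i : ι} {k : G} (hk : k ≠ 1)
    (w : {w : Word (fun _ : ι => G) // w.fstIdx ≠ some i}) :
    ((wordEquiv i).symm (k, w)).fstIdx = some i := by
  change (Word.rcons (⟨k, w.1, w.2⟩ : Word.Pair (fun _ : ι => G) i)).fstIdx = _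
  rw [Word.rcons, dif_neg hk, Word.fstIdx_cons]

/-- The vacuum vector. -/
noncomputable def wordVacuum (ι G : Type*) [DecidableEq ι] [DecidableEq G] [Monoid G] :
    lp (fun _ : Word (fun _ : ι => G) => ℂ) 2 :=
  lp.single 2 Word.empty (1 : ℂ)

lemma norm_wordVacuum : ‖wordVacuum ι G‖ = 1 := by
  simp [wordVacuum, lp.norm_single]

lemma wordVacuum_apply_ne {v : Word (fun _ : ι => G)} (hv : v ≠ Word.empty) :
    wordVacuum ι G v = 0 := by
  simp [wordVacuum, hv]

@[simp]
lemma wordVacuum_apply_empty : wordVacuum ι G Word.empty = 1 := by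
  simp [wordVacuum]

lemma vectorState_wordVacuum (T : lp (fun _ : Word (fun _ : ι => G) => ℂ) 2 →L[ℂ]
    lp (fun _ : Word (fun _ : ι => G) => ℂ) 2) :
    vectorState (wordVacuum ι G) T = T (wordVacuum ι G) Word.empty := by
  rw [vectorState_apply]
  nth_rewrite 1 [wordVacuum]
  rw [lp.inner_single_left]
  simp

variable [Fintype G]

/-- The empty word has first coordinate `1 : G`, so the vacuum sees the matrix through its basis
vector at 1. -/
lemma vectorState_wordVacuum_matrixOp (i : ι) (T : Matrix G G ℂ) :
    vectorState (wordVacuum ι G) (matrixOp (wordEquiv i) T) = T 1 1 := by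
  have h0 : (Word.empty : Word (fun _ : ι => G)).fstIdx ≠ some i := by simp [Word.fstIdx]
  have h1 : (wordEquiv i).symm (1, ⟨Word.empty, h0⟩) = (Word.empty : Word (fun _ : ι => G)) := by
    rw [Equiv.symm_apply_eq, wordEquiv_of_fstIdx_ne h0]
  rw [vectorState_wordVacuum, matrixOp_apply, wordEquiv_of_fstIdx_ne h0,
    Finset.sum_eq_single_of_mem 1 (Finset.mem_univ _), h1, wordVacuum_apply_empty, mul_one]
  intro k _ hk
  rw [wordVacuum_apply_ne, mul_zero]
  intro h
  have := fstIdx_wordEquiv_symm hk ⟨Word.empty, h0⟩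
  rw [h] at this
  exact h0 this

/-- The copies of the matrix algebra are free with respect to the vacuum state. -/
theorem areFreeSubalgebras_matrixOp :
    AreFreeSubalgebras (vectorState (wordVacuum ι G))
      (fun i => (matrixOpHom (wordEquiv (G := G) i)).range) := by
  -- Applying an alternating product of centred elements to the vacuum gives a vector supported on
  -- words whose first index is that of the leftmost factor; the empty word is therefore excluded.
  have key : ∀ l : List (ι × _), l.IsChain (fun p q => p.1 ≠ q.1) →
      (∀ p ∈ l, p.2 ∈ (matrixOpHom (wordEquiv (G := G) p.1)).range ∧
        vectorState (wordVacuum ι G) p.2 = 0) → ∀ v,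
      (l.map Prod.snd).prod (wordVacuum ι G) v ≠ 0 → v.fstIdx = l.head?.map Prod.fst := by
    intro l
    induction l with
    | nil =>
      intro _ _ v hv
      have : v = Word.empty := by
        by_contra h
        exact hv (wordVacuum_apply_ne h)
      simp [this, Word.fstIdx]
    | cons p l ih =>
      intro hch hcen v hv
      rw [List.isChain_cons] at hch
      obtain ⟨i, y⟩ := p
      obtain ⟨⟨S, hSy⟩, hS⟩ := hcen (i, y) (by simp)
      replace hSy : matrixOp (wordEquiv i) S = y := hSy
      subst hSy
      rw [vectorState_wordVacuum_matrixOp] at hS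
      rw [List.map_cons, List.prod_cons] at hv
      change matrixOp (wordEquiv i) S ((l.map Prod.snd).prod (wordVacuum ι G)) v ≠ 0 at hv
      rw [matrixOp_apply] at hv
      obtain ⟨k, -, hk⟩ := Finset.exists_ne_zero_of_sum_ne_zero hv
      have h1 := ih hch.2 (fun q hq => hcen q (List.mem_cons_of_mem _ hq)) _
        (right_ne_zero_of_mul hk)
      -- A nontrivial letter would make the previous vector charge a word starting with `i`, against
      -- alternation. So only the diagonal entry at 1 contributes, and it is 0 by centring.
      have hk1 : k = 1 := by
        by_contra hk1
        rw [fstIdx_wordEquiv_symm hk1] at h1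
        obtain ⟨q, hq, hqi⟩ := Option.map_eq_some_iff.1 h1.symm
        exact hch.1 q hq hqi.symm
      subst hk1
      by_contra hne
      have hne' : v.fstIdx ≠ some i := by simpa using hne
      rw [wordEquiv_of_fstIdx_ne hne'] at hk
      exact left_ne_zero_of_mul hk hS
  intro l hl hch hcen
  rw [vectorState_wordVacuum]
  by_contra h
  have := key l hch hcen _ h
  obtain ⟨p, l, rfl⟩ := List.exists_cons_of_ne_nil hl
  simp [Word.fstIdx] at this

end FreeProduct

/-! ### Finitely supported laws realised by free operators -/

/-- A finitely supported law is the law of a Hermitian matrix with respect to a basis vector. -/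
lemma exists_isHermitian_pow_apply {G : Type*} [Fintype G] [DecidableEq G] (w : G → ℝ≥0) (hw : ∑ g, w g = 1) (z : G → ℝ) (o : G) :
    ∃ T : Matrix G G ℂ, IsSelfAdjoint T ∧
      ∀ k : ℕ, (T ^ k) o o = ((∑ g, w g * z g ^ k : ℝ) : ℂ) := by
  -- For diagonal D, ⟨ξ, D^k ξ⟩ = ∑ w z^k with ξ = √w. In an orthonormal basis with `b o = ξ` this
  -- becomes the entry at (o, o).
  let ξ : EuclideanSpace ℂ G := WithLp.toLp 2 fun g => ((Real.sqrt (w g) : ℝ) : ℂ)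
  have hξ : ‖ξ‖ = 1 := by
    rw [EuclideanSpace.norm_eq, Real.sqrt_eq_one]
    have : ∀ g, ‖ξ g‖ ^ 2 = w g := fun g => by
      simp [ξ, abs_of_nonneg, Real.sq_sqrt]
    simp_rw [this]
    exact_mod_cast hw
  obtain ⟨b, hb⟩ : ∃ b : OrthonormalBasis G ℂ (EuclideanSpace ℂ G), b o = ξ := by
    have horth : Orthonormal ℂ (Set.domRestrict {o} fun _ : G => ξ) :=
      ⟨fun _ => hξ, fun i j hij => (hij (Subsingleton.elim i j)).elim⟩
    obtain ⟨b, hb⟩ := horth.exists_orthonormalBasis_extension_of_card_eq (by simp)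
    exact ⟨b, hb o rfl⟩
  let D : EuclideanSpace ℂ G →ₗ[ℂ] EuclideanSpace ℂ G :=
    (LinearMap.toMatrixOrthonormal (EuclideanSpace.basisFun G ℂ)).symm
      (Matrix.diagonal fun g => (z g : ℂ))
  refine ⟨LinearMap.toMatrixOrthonormal b D, ?_, fun k => ?_⟩
  · have hd : IsSelfAdjoint (Matrix.diagonal fun g => (z g : ℂ)) := by
      rw [IsSelfAdjoint, Matrix.star_eq_conjTranspose, Matrix.diagonal_conjTranspose]
      congr 1
      ext g
      simp
    exact (hd.map _).map _
  · rw [← map_pow, ← map_pow, Matrix.diagonal_pow, LinearMap.toMatrixOrthonormal_apply_apply, hb]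
    have : ∀ g, ((LinearMap.toMatrixOrthonormal (EuclideanSpace.basisFun G ℂ)).symm
        (Matrix.diagonal ((fun g => (z g : ℂ)) ^ k)) ξ) g = (z g : ℂ) ^ k * ξ g := by
      intro g
      change (Matrix.diagonal ((fun g => (z g : ℂ)) ^ k)).mulVec ξ.ofLp g = _
      rw [Matrix.mulVec_diagonal, Pi.pow_apply]
    rw [PiLp.inner_apply]
    simp only [this]
    rw [Complex.ofReal_sum]
    refine Finset.sum_congr rfl fun g _ => ?_
    have h2 : ((Real.sqrt (w g) : ℝ) : ℂ) * ((Real.sqrt (w g) : ℝ) : ℂ) = ((w g : ℝ) : ℂ) := by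
      rw [← Complex.ofReal_mul, Real.mul_self_sqrt (NNReal.coe_nonneg _)]
    simp only [ξ, RCLike.inner_apply, Complex.conj_ofReal]
    rw [mul_assoc, h2]
    push_cast
    ring

/-- Free selfadjoint operators with a common finitely supported law. -/
theorem exists_free_selfAdjoint_family (s : ℕ) (w : Fin (s + 1) → ℝ≥0) (hw : ∑ g, w g = 1)
    (z : Fin (s + 1) → ℝ) :
    ∃ (H : Type) (_ : NormedAddCommGroup H) (_ : InnerProductSpace ℂ H) (_ : CompleteSpace H)
      (Ω : H) (x : ℕ → H →L[ℂ] H), ‖Ω‖ = 1 ∧ (∀ i, IsSelfAdjoint (x i)) ∧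
      AreFree (vectorState Ω) x ∧
      ∀ i k, vectorState Ω (x i ^ k) = ((∑ g, w g * z g ^ k : ℝ) : ℂ) := by
  -- The group law plays no role beyond giving reduced words; its unit marks the vacuum basis
  -- vector.
  let G := Multiplicative (Fin (s + 1))
  obtain ⟨T, hT, hTk⟩ := exists_isHermitian_pow_apply (G := G)
    (fun g => w g.toAdd) ((Equiv.sum_comp Multiplicative.toAdd w).trans hw) (fun g => z g.toAdd) 1
  refine ⟨lp (fun _ : Monoid.CoprodI.Word (fun _ : ℕ => G) => ℂ) 2, inferInstance, inferInstance,
    inferInstance, wordVacuum ℕ G, fun i => matrixOp (wordEquiv i) T, norm_wordVacuum, ?_, ?_, ?_⟩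
  · intro i
    rw [IsSelfAdjoint, star_matrixOp, hT.star_eq]
  · intro l hl hch hcen
    refine areFreeSubalgebras_matrixOp l hl hch fun p hp => ⟨?_, (hcen p hp).2⟩
    have hle : Algebra.adjoin ℂ {matrixOp (wordEquiv p.1) T} ≤
        (matrixOpHom (wordEquiv (G := G) p.1)).range :=
      Algebra.adjoin_le (Set.singleton_subset_iff.2 ⟨T, rfl⟩)
    exact hle (hcen p hp).1
  · intro i k
    change vectorState _ (matrixOp (wordEquiv i) T ^ k) = _
    rw [← matrixOpHom_apply, ← map_pow, matrixOpHom_apply, vectorState_wordVacuum_matrixOp, hTk]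
    exact congrArg Complex.ofReal
      (Equiv.sum_comp Multiplicative.toAdd fun g => (w g : ℝ) * z g ^ k)

/-! ### The compound free Poisson law on the full Fock space -/

section Fock

variable {ι : Type*} [DecidableEq ι]

/-- The partial permutation of words which removes the first letter `i`. -/
def consPEquiv (i : ι) : List ι ≃. List ι where
  toFun
    | [] => none
    | j :: w => if j = i then some w else none
  invFun w := some (i :: w)
  inv a b := by
    cases a with
    | nil => simp
    | cons j w =>
      by_cases h : j = i
      · simp [h, eq_comm]
      · simp [h, Ne.symm h]

/-- The free creation operator. -/
noncomputable def creation (i : ι) : lp (fun _ : List ι => ℂ) 2 →L[ℂ] lp (fun _ : List ι => ℂ) 2 :=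
  pequivOp (consPEquiv i)

/-- The vacuum vector of the full Fock space. -/
noncomputable def fockVacuum (ι : Type*) [DecidableEq ι] : lp (fun _ : List ι => ℂ) 2 :=
  lp.single 2 [] (1 : ℂ)

lemma norm_fockVacuum : ‖fockVacuum ι‖ = 1 := by
  simp [fockVacuum, lp.norm_single]

lemma fockVacuum_apply (w : List ι) : fockVacuum ι w = if w = [] then 1 else 0 := by
  by_cases h : w = []
  · subst h; simp [fockVacuum]
  · simp [fockVacuum, h]

lemma vectorState_fockVacuum
    (T : lp (fun _ : List ι => ℂ) 2 →L[ℂ] lp (fun _ : List ι => ℂ) 2) :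
    vectorState (fockVacuum ι) T = T (fockVacuum ι) [] := by
  rw [vectorState_apply]
  nth_rewrite 1 [fockVacuum]
  rw [lp.inner_single_left]
  simp

@[simp]
lemma creation_apply_nil (i : ι) (f : lp (fun _ : List ι => ℂ) 2) : creation i f [] = 0 := rfl

/-- `pequivOp` precomposes, so deleting a letter from words creates that letter on vectors. -/
lemma creation_apply_cons (i j : ι) (f : lp (fun _ : List ι => ℂ) 2) (w : List ι) :
    creation i f (j :: w) = if j = i then f w else 0 := by
  change Option.elim (if j = i then some w else none) 0 f = _
  split_ifs <;> rfl

lemma star_creation_apply (i : ι) (f : lp (fun _ : List ι => ℂ) 2) (w : List ι) :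
    (star (creation i) : lp (fun _ : List ι => ℂ) 2 →L[ℂ] lp (fun _ : List ι => ℂ) 2) f w =
      f (i :: w) := by
  rw [creation, star_pequivOp]
  rfl

/-- A free Poisson variable of parameter `a ^ 2`. -/
noncomputable def fockPoisson (a : ℝ) (i : ι) :
    lp (fun _ : List ι => ℂ) 2 →L[ℂ] lp (fun _ : List ι => ℂ) 2 :=
  (creation i + (a : ℂ) • 1) * star (creation i + (a : ℂ) • 1)

lemma fockPoisson_eq (a : ℝ) (i : ι) : fockPoisson a i =
    creation i * star (creation i) + (a : ℂ) • creation i + (a : ℂ) • star (creation i) +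
      ((a : ℂ) * a) • 1 := by
  simp only [fockPoisson, star_add, star_smul, star_one, add_mul, mul_add, smul_mul_assoc,
    mul_smul_comm, mul_one, one_mul, smul_add, smul_smul, RCLike.star_def, Complex.conj_ofReal]
  abel

lemma fockPoisson_apply_nil (a : ℝ) (i : ι) (f : lp (fun _ : List ι => ℂ) 2) :
    fockPoisson a i f [] = a * (f [i] + a * f []) := by
  rw [fockPoisson_eq]
  change creation i ((star (creation i) : _ →L[ℂ] _) f) [] + a * creation i f [] +
    a * (star (creation i) : _ →L[ℂ] _) f [] + a * a * f [] = _
  rw [star_creation_apply, creation_apply_nil, creation_apply_nil]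
  ring

lemma fockPoisson_apply_cons (a : ℝ) (i j : ι) (f : lp (fun _ : List ι => ℂ) 2) (w : List ι) :
    fockPoisson a i f (j :: w) = (if j = i then f (i :: w) + a * f w else 0) +
      a * (f (i :: j :: w) + a * f (j :: w)) := by
  rw [fockPoisson_eq]
  change creation i ((star (creation i) : _ →L[ℂ] _) f) (j :: w) + a * creation i f (j :: w) +
    a * (star (creation i) : _ →L[ℂ] _) f (j :: w) + a * a * f (j :: w) = _
  rw [star_creation_apply, creation_apply_cons, creation_apply_cons, star_creation_apply]
  split_ifs <;> ring

open PowerSeries in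
/-- The series `a z t / (1 - z t)`. -/
noncomputable def fockSeries (a z : ℝ) : PowerSeries ℂ :=
  X * PowerSeries.mk fun n => (a : ℂ) * (z : ℂ) ^ (n + 1)

open PowerSeries in
-- This fixed-point equation is exactly what lets product vectors solve the resolvent equation on
-- the Fock space.
lemma fockSeries_eq (a z : ℝ) :
    fockSeries a z = C (z : ℂ) * X * (fockSeries a z + C (a : ℂ)) := by
  ext n
  cases n with
  | zero => simp [fockSeries]
  | succ n =>
    rw [mul_assoc, coeff_C_mul, coeff_succ_X_mul, fockSeries, coeff_succ_X_mul, map_add]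
    cases n with
    | zero => simp; ring
    | succ n =>
      rw [coeff_succ_X_mul]
      simp
      ring

variable [Fintype ι]

/-- A compound free Poisson variable, on the full Fock space. -/
noncomputable def fockCompoundPoisson (a z : ι → ℝ) :
    lp (fun _ : List ι => ℂ) 2 →L[ℂ] lp (fun _ : List ι => ℂ) 2 :=
  ∑ i, (z i : ℂ) • fockPoisson (a i) i

lemma isSelfAdjoint_fockCompoundPoisson (a z : ι → ℝ) :
    IsSelfAdjoint (fockCompoundPoisson a z) :=
  isSelfAdjoint_sum _ fun _ _ =>
    IsSelfAdjoint.smul (Complex.conj_ofReal _) (IsSelfAdjoint.mul_star_self _)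

lemma fockCompoundPoisson_apply (a z : ι → ℝ) (f : lp (fun _ : List ι => ℂ) 2) (w : List ι) :
    fockCompoundPoisson a z f w = ∑ i, (z i : ℂ) * fockPoisson (a i) i f w := by
  have : fockCompoundPoisson a z f w = ∑ i, ((z i : ℂ) • fockPoisson (a i) i) f w := by
    simp only [fockCompoundPoisson, sum_apply, lp.coeFn_sum, Finset.sum_apply]
  rw [this]
  rfl

open PowerSeries in
/-- The vector `freeAppell R X Ω` has explicit coefficients. -/
lemma freeAppell_fockCompoundPoisson_apply (a z : ι → ℝ) (n : ℕ) (w : List ι) :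
    freeAppell (fun n => ∑ i, (a i : ℂ) ^ 2 * (z i : ℂ) ^ (n + 1)) (fockCompoundPoisson a z) n
      (fockVacuum ι) w = coeff n (w.map fun i => fockSeries (a i) (z i)).prod := by
  set R : ℕ → ℂ := fun n => ∑ i, (a i : ℂ) ^ 2 * (z i : ℂ) ^ (n + 1) with hR
  set V : List ι → PowerSeries ℂ := fun w => (w.map fun i => fockSeries (a i) (z i)).prod with hV
  have hVc : ∀ i w, V (i :: w) = fockSeries (a i) (z i) * V w := fun i w => by simp [hV]
  -- The action of `fockPoisson (a i) i` on the candidate vector `V`, coefficientwise in t.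
  let P : ι → List ι → PowerSeries ℂ := fun i w => match w with
    | [] => C (a i : ℂ) * (V [i] + C (a i : ℂ) * V [])
    | j :: w => (if j = i then V (i :: w) + C (a i : ℂ) * V w else 0) +
      C (a i : ℂ) * (V (i :: j :: w) + C (a i : ℂ) * V (j :: w))
  have hRs : X * PowerSeries.mk R =
      ∑ i, X * C (z i : ℂ) * (C (a i : ℂ) * (fockSeries (a i) (z i) + C (a i : ℂ))) := by
    ext n
    cases n with
    | zero => simp [mul_assoc]
    | succ n =>
      rw [coeff_succ_X_mul, coeff_mk, map_sum]
      refine Finset.sum_congr rfl fun i _ => ?_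
      have : X * C (z i : ℂ) * (C (a i : ℂ) * (fockSeries (a i) (z i) + C (a i : ℂ))) =
          C (a i : ℂ) * fockSeries (a i) (z i) := by
        conv_rhs => rw [fockSeries_eq (a i) (z i)]
        ring
      rw [this, coeff_C_mul, fockSeries, coeff_succ_X_mul, coeff_mk]
      ring
  -- The resolvent equation (1 + t R - t X) V = Ω. The scalar part of R cancels every summand
  -- except, at a word `j :: w`, the one with i = j, where `fockSeries_eq` finishes.
  have hser : ∀ w, V w + X * PowerSeries.mk R * V w - ∑ i, X * C (z i : ℂ) * P i w =
      if w = [] then 1 else 0 := by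
    intro w
    rw [hRs, Finset.sum_mul]
    cases w with
    | nil =>
      rw [if_pos rfl, add_sub_assoc, ← Finset.sum_sub_distrib, Finset.sum_eq_zero, add_zero]
      · simp [hV]
      · intro i _
        simp only [P, hVc]
        ring
    | cons j w =>
      rw [if_neg (by simp), add_sub_assoc, ← Finset.sum_sub_distrib,
        Finset.sum_eq_single_of_mem j (Finset.mem_univ j)]
      · simp only [P, hVc, if_true]
        linear_combination V w * fockSeries_eq (a j) (z j)
      · intro i _ hij
        simp only [P, hVc, if_neg hij.symm]
        ring
  have hP : ∀ (n : ℕ) (f : lp (fun _ : List ι => ℂ) 2), (∀ w, f w = coeff n (V w)) → ∀ i w,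
      fockPoisson (a i) i f w = coeff n (P i w) := by
    intro n f hf i w
    cases w with
    | nil => simp only [fockPoisson_apply_nil, P, hf, coeff_C_mul, map_add]
    | cons j w =>
      simp only [fockPoisson_apply_cons, P, hf, coeff_C_mul, map_add]
      split_ifs <;> simp
  change _ = coeff n (V w)
  induction n using Nat.strong_induction_on generalizing w with
  | _ n ih =>
    cases n with
    | zero =>
      have h := congrArg (coeff 0) (hser w)
      simp only [map_sub, map_add, map_sum, mul_assoc, coeff_zero_X_mul, Finset.sum_const_zero,
        add_zero, sub_zero] at h
      rw [h, freeAppell_zero, one_apply_eq_self, fockVacuum_apply]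
      split_ifs <;> simp
    | succ n =>
      have h := congrArg (coeff (n + 1)) (hser w)
      have h0 : coeff (n + 1) (if w = [] then (1 : PowerSeries ℂ) else 0) = 0 := by
        split_ifs <;> simp [coeff_one]
      simp only [map_sub, map_add, map_sum, mul_assoc, coeff_succ_X_mul, coeff_C_mul, h0] at h
      have h1 : coeff n (PowerSeries.mk R * V w) = ∑ i ∈ Finset.range (n + 1),
          R i * coeff (n - i) (V w) := by
        rw [coeff_mul, Finset.Nat.sum_antidiagonal_eq_sum_range_succ_mk]
        simp
      have h2 : freeAppell R (fockCompoundPoisson a z) (n + 1) (fockVacuum ι) w =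
          (∑ i, (z i : ℂ) * coeff n (P i w)) -
            ∑ i ∈ Finset.range (n + 1), R i * coeff (n - i) (V w) := by
        rw [freeAppell_succ, sub_apply, lp.coeFn_sub, Pi.sub_apply, mul_apply_eq_comp,
          fockCompoundPoisson_apply]
        congr 1
        · exact Finset.sum_congr rfl fun i _ => by rw [hP n _ (fun w => ih n (by omega) w)]
        · simp only [sum_apply, lp.coeFn_sum, Finset.sum_apply]
          refine Finset.sum_congr rfl fun i _ => ?_
          rw [← ih (n - i) (by omega) w]
          rfl
      rw [h2, ← h1]
      linear_combination -h

/-- The compound free Poisson law, given by its free cumulants. -/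
theorem exists_isFreeCumulants_sum_pow {ι : Type} [Fintype ι] (c : ι → ℝ≥0) (z : ι → ℝ) :
    ∃ μ : Measure ℝ, IsProbabilityMeasure μ ∧ (∃ K : Set ℝ, IsCompact K ∧ μ Kᶜ = 0) ∧
      IsFreeCumulants (fun k => ((∫ x, x ^ k ∂μ : ℝ) : ℂ))
        (fun n => ∑ i, (c i : ℂ) * (z i : ℂ) ^ (n + 1)) := by
  classical
  -- `fockPoisson a` has parameter a², hence the square roots.
  let X := fockCompoundPoisson (fun i => Real.sqrt (c i)) z
  obtain ⟨μ, hμ⟩ := exists_hasNCLaw_vectorState (norm_fockVacuum (ι := ι))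
    (isSelfAdjoint_fockCompoundPoisson (fun i => Real.sqrt (c i)) z)
  refine ⟨μ, hμ.1, hμ.2, ?_⟩
  simp_rw [← hμ.3]
  rw [isFreeCumulants_iff (isNCState_vectorState norm_fockVacuum).map_one]
  intro n
  have h := freeAppell_fockCompoundPoisson_apply (fun i => Real.sqrt (c i)) z (n + 1) []
  have hsq : ∀ i, ((Real.sqrt (c i) : ℝ) : ℂ) ^ 2 = (c i : ℂ) := fun i => by
    rw [← Complex.ofReal_pow, Real.sq_sqrt (NNReal.coe_nonneg _)]
  simp only [hsq, List.map_nil, List.prod_nil, PowerSeries.coeff_one, Nat.succ_ne_zero,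
    if_false] at h
  rw [vectorState_fockVacuum]
  exact h

end Fock

/-! ### The method of moments -/

/-- Taylor's formula for the exponential on the imaginary axis. -/
lemma norm_exp_I_mul_sub_sum_le (n : ℕ) (x : ℝ) :
    ‖Complex.exp (x * Complex.I) - ∑ k ∈ Finset.range n, (x * Complex.I) ^ k / (k.factorial : ℂ)‖
      ≤ |x| ^ n / n.factorial := by
  induction n generalizing x with
  | zero => simp [Complex.norm_exp_ofReal_mul_I]
  | succ n ih =>
    -- The Taylor remainder along the segment from 0 to x: the derivative of `g (n + 1)` is i x `g
    -- n`, so bounds integrate up.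
    let g : ℕ → ℝ → ℂ := fun n s => Complex.exp ((s * x : ℝ) * Complex.I) -
      ∑ k ∈ Finset.range n, ((s * x : ℝ) * Complex.I) ^ k / (k.factorial : ℂ)
    have hlin : ∀ s : ℝ, HasDerivAt (fun s : ℝ => ((s * x : ℝ) : ℂ) * Complex.I)
        (x * Complex.I) s := fun s => by
      have := ((hasDerivAt_id s).mul_const x).ofReal_comp.mul_const Complex.I
      simpa using this
    have hder : ∀ s : ℝ, HasDerivAt (g (n + 1)) (x * Complex.I * g n s) s := by
      intro s
      have h1 := (hlin s).cexp
      have h2 : HasDerivAt (fun s : ℝ => ∑ k ∈ Finset.range (n + 1),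
          (((s * x : ℝ) : ℂ) * Complex.I) ^ k / (k.factorial : ℂ))
          (∑ k ∈ Finset.range (n + 1), ((k : ℂ) * (((s * x : ℝ) : ℂ) * Complex.I) ^ (k - 1) *
            (x * Complex.I)) / (k.factorial : ℂ)) s :=
        HasDerivAt.fun_sum fun k _ => ((hlin s).fun_pow k).div_const _
      refine (h1.sub h2).congr_deriv ?_
      simp only [g]
      rw [Finset.sum_range_succ', mul_sub, Finset.mul_sum]
      congr 1
      · ring
      · simp only [Nat.cast_zero, zero_mul, zero_div, add_zero]
        refine Finset.sum_congr rfl fun k _ => ?_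
        rw [Nat.factorial_succ, Nat.add_sub_cancel]
        have : (k.factorial : ℂ) ≠ 0 := by exact_mod_cast k.factorial_ne_zero
        have : ((k : ℂ) + 1) ≠ 0 := by exact_mod_cast k.succ_ne_zero
        push_cast
        field_simp
    have hB : ∀ s : ℝ, HasDerivAt (fun s : ℝ => |x| ^ (n + 1) * s ^ (n + 1) / (n + 1).factorial)
        (|x| ^ (n + 1) * s ^ n / n.factorial) s := by
      intro s
      have := ((hasDerivAt_pow (n + 1) s).const_mul (|x| ^ (n + 1))).div_const
        ((n + 1).factorial : ℝ)
      refine this.congr_deriv ?_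
      rw [Nat.factorial_succ]
      have : (n.factorial : ℝ) ≠ 0 := by exact_mod_cast n.factorial_ne_zero
      push_cast
      field_simp
    have key := image_norm_le_of_norm_deriv_right_le_deriv_boundary (f := g (n + 1)) (a := 0)
      (b := 1) (f' := fun s => x * Complex.I * g n s)
      (B := fun s : ℝ => |x| ^ (n + 1) * s ^ (n + 1) / (n + 1).factorial)
      (B' := fun s : ℝ => |x| ^ (n + 1) * s ^ n / n.factorial)
      (fun s _ => (hder s).continuousAt.continuousWithinAt)
      (fun s _ => (hder s).hasDerivWithinAt)
      (by
        simp only [g]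
        rw [Finset.sum_range_succ']
        simp)
      hB
      (by
        intro s hs
        have h := ih (s * x)
        rw [norm_mul, norm_mul, Complex.norm_real, Complex.norm_I, mul_one, Real.norm_eq_abs]
        calc |x| * ‖g n s‖ ≤ |x| * (|s * x| ^ n / n.factorial) := by gcongr
          _ = _ := by rw [abs_mul, abs_of_nonneg hs.1, mul_pow]; ring)
      (Set.right_mem_Icc.2 zero_le_one)
    simpa [g] using key

lemma integrable_of_compact_support {E : Type*} [NormedAddCommGroup E] {μ : Measure ℝ}
    [IsFiniteMeasure μ]
    (hμ : ∃ K : Set ℝ, IsCompact K ∧ μ Kᶜ = 0) {f : ℝ → E} (hf : Continuous f) :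
    Integrable f μ := by
  obtain ⟨K, hK, hμK⟩ := hμ
  have := hf.continuousOn.integrableOn_compact (μ := μ) hK
  rwa [IntegrableOn, Measure.restrict_eq_self_of_ae_mem (mem_ae_iff.2 hμK)] at this

/-- The order is even so that |x|^(2N) = x^(2N), and the Taylor error is controlled by a moment
rather than an absolute moment. -/
lemma norm_charFun_sub_sum_le {μ : Measure ℝ} [IsProbabilityMeasure μ]
    (hμ : ∃ K : Set ℝ, IsCompact K ∧ μ Kᶜ = 0) (t : ℝ) (N : ℕ) :
    ‖charFun μ t - ∑ k ∈ Finset.range (2 * N), (t * Complex.I) ^ k / (k.factorial : ℂ) *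
      ((∫ x, x ^ k ∂μ : ℝ) : ℂ)‖ ≤ |t| ^ (2 * N) / (2 * N).factorial * ∫ x, x ^ (2 * N) ∂μ := by
  have hint : ∀ k : ℕ, Integrable (fun x : ℝ => (t * Complex.I) ^ k / (k.factorial : ℂ) *
      ((x ^ k : ℝ) : ℂ)) μ := fun k =>
    integrable_of_compact_support hμ (by fun_prop)
  have h1 : ∑ k ∈ Finset.range (2 * N), (t * Complex.I) ^ k / (k.factorial : ℂ) *
      ((∫ x, x ^ k ∂μ : ℝ) : ℂ) = ∫ x, ∑ k ∈ Finset.range (2 * N),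
        (t * Complex.I) ^ k / (k.factorial : ℂ) * ((x ^ k : ℝ) : ℂ) ∂μ := by
    rw [integral_finsetSum _ fun k _ => hint k]
    refine Finset.sum_congr rfl fun k _ => ?_
    rw [integral_const_mul, ← integral_complex_ofReal]
  rw [h1, charFun_apply_real, ← integral_sub (integrable_of_compact_support hμ (by fun_prop))
    (integrable_finsetSum _ fun k _ => hint k), ← integral_const_mul]
  refine norm_integral_le_of_norm_le
    (integrable_of_compact_support hμ (by fun_prop)) (Eventually.of_forall fun x => ?_)
  have h2 := norm_exp_I_mul_sub_sum_le (2 * N) (t * x)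
  have h3 : |t * x| ^ (2 * N) = |t| ^ (2 * N) * x ^ (2 * N) := by
    rw [abs_mul, mul_pow, pow_mul |x|, sq_abs, ← pow_mul]
  rw [h3, mul_div_right_comm] at h2
  have h4 : ∀ k : ℕ, (t * Complex.I) ^ k / (k.factorial : ℂ) * ((x ^ k : ℝ) : ℂ) =
      ((t * x : ℝ) * Complex.I) ^ k / (k.factorial : ℂ) := fun k => by
    push_cast
    ring
  simpa only [h4, ← Complex.ofReal_mul] using h2

/-- The method of moments, for a compactly supported limit. -/
theorem tendsto_of_tendsto_moments {ν : ℕ → ProbabilityMeasure ℝ} {π : ProbabilityMeasure ℝ}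
    (hν : ∀ᶠ n in atTop, ∃ K : Set ℝ, IsCompact K ∧ (ν n : Measure ℝ) Kᶜ = 0)
    (hπ : ∃ K : Set ℝ, IsCompact K ∧ (π : Measure ℝ) Kᶜ = 0)
    (h : ∀ k : ℕ, Tendsto (fun n => ∫ x, x ^ k ∂(ν n : Measure ℝ)) atTop
      (𝓝 (∫ x, x ^ k ∂(π : Measure ℝ)))) :
    Tendsto ν atTop (𝓝 π) := by
  rw [ProbabilityMeasure.tendsto_iff_tendsto_charFun]
  intro t
  obtain ⟨C, hC⟩ : ∃ C : ℝ, ∀ N : ℕ, ∫ x, x ^ (2 * N) ∂(π : Measure ℝ) ≤ C ^ (2 * N) := by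
    obtain ⟨K, hK, hπK⟩ := hπ
    obtain ⟨C, hC⟩ := hK.isBounded.exists_norm_le
    refine ⟨C, fun N => ?_⟩
    have : ∫ x, x ^ (2 * N) ∂(π : Measure ℝ) ≤ ∫ _, C ^ (2 * N) ∂(π : Measure ℝ) := by
      refine integral_mono_ae (integrable_of_compact_support ⟨K, hK, hπK⟩ (by fun_prop))
        (integrable_const _) ?_
      filter_upwards [mem_ae_iff.2 hπK] with x hx
      have h1 := pow_le_pow_left₀ (norm_nonneg x) (hC x hx) (2 * N)
      rwa [Real.norm_eq_abs, pow_mul, sq_abs, ← pow_mul] at h1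
    simpa using this
  rw [Metric.tendsto_nhds]
  intro ε hε
  -- The factor 2 accounts for two Taylor errors, of `π` and, in the limit, of `ν n`.
  have hlim : Tendsto (fun N : ℕ => 2 * ((|t| * C) ^ (2 * N) / (2 * N).factorial)) atTop (𝓝 0) := by
    have h1 := (FloorSemiring.tendsto_pow_div_factorial_atTop (|t| * C)).comp
      (tendsto_id.const_mul_atTop' (show 0 < 2 by norm_num))
    simpa using h1.const_mul 2
  obtain ⟨N, hN⟩ := (hlim.eventually (gt_mem_nhds hε)).exists
  set a : ℝ := |t| ^ (2 * N) / (2 * N).factorial with ha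
  have ha0 : 0 ≤ a := by positivity
  let D : ℕ → ℂ := fun n => ∑ k ∈ Finset.range (2 * N), (t * Complex.I) ^ k / (k.factorial : ℂ) *
      ((∫ x, x ^ k ∂(ν n : Measure ℝ) : ℝ) : ℂ)
  let D' : ℂ := ∑ k ∈ Finset.range (2 * N), (t * Complex.I) ^ k / (k.factorial : ℂ) *
      ((∫ x, x ^ k ∂(π : Measure ℝ) : ℝ) : ℂ)
  have hb : Tendsto (fun n => a * (∫ x, x ^ (2 * N) ∂(ν n : Measure ℝ)) + ‖D n - D'‖ +
      a * (∫ x, x ^ (2 * N) ∂(π : Measure ℝ))) atTop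
      (𝓝 (a * (∫ x, x ^ (2 * N) ∂(π : Measure ℝ)) + 0 +
        a * (∫ x, x ^ (2 * N) ∂(π : Measure ℝ)))) := by
    refine (((h (2 * N)).const_mul a).add ?_).add_const _
    rw [← tendsto_iff_norm_sub_tendsto_zero]
    exact tendsto_finsetSum _ fun k _ =>
      ((Complex.continuous_ofReal.tendsto _).comp (h k)).const_mul _
  have hlt : a * (∫ x, x ^ (2 * N) ∂(π : Measure ℝ)) + 0 +
      a * (∫ x, x ^ (2 * N) ∂(π : Measure ℝ)) < ε := by
    refine lt_of_le_of_lt ?_ hN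
    have := mul_le_mul_of_nonneg_left (hC N) ha0
    have h2 : a * C ^ (2 * N) = (|t| * C) ^ (2 * N) / (2 * N).factorial := by
      rw [ha, mul_pow]; ring
    linarith
  filter_upwards [hb.eventually (gt_mem_nhds hlt), hν] with n hn hνn
  refine lt_of_le_of_lt ?_ hn
  have h1 := norm_charFun_sub_sum_le hνn t N
  have h2 := norm_charFun_sub_sum_le hπ t N
  rw [norm_sub_rev] at h2
  rw [dist_eq_norm]
  have h3 : charFun (ν n : Measure ℝ) t - charFun (π : Measure ℝ) t =
      (charFun (ν n : Measure ℝ) t - D n) + (D n - D') + (D' - charFun (π : Measure ℝ) t) := by ring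
  rw [h3]
  exact (norm_add₃_le).trans (add_le_add (add_le_add h1 le_rfl) h2)

/-! ### The discrete approximations of the compound Poisson laws -/

section PoissonStep

variable {s : ℕ} (c : Fin s → ℝ≥0) (z : Fin s → ℝ)

instance : IsFiniteMeasure (discreteMeasure c z) := by
  rw [discreteMeasure]
  infer_instance

lemma integral_discreteMeasure {E : Type*} [NormedAddCommGroup E] [NormedSpace ℝ E]
    [CompleteSpace E] (f : ℝ → E) :
    Integrable f (discreteMeasure c z) ∧
      ∫ x, f x ∂(discreteMeasure c z) = ∑ i, (c i : ℝ) • f (z i) := by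
  have hint : ∀ i, Integrable f (c i • Measure.dirac (z i)) := fun i =>
    (integrable_dirac (by simp)).smul_measure_nnreal
  refine ⟨?_, ?_⟩
  · rw [discreteMeasure]
    exact integrable_finsetSum_measure.2 fun i _ => hint i
  · rw [discreteMeasure, integral_finsetSum_measure fun i _ => hint i]
    refine Finset.sum_congr rfl fun i _ => ?_
    rw [integral_smul_nnreal_measure, integral_dirac]
    rfl

lemma discreteMeasure_real_univ : (discreteMeasure c z).real Set.univ = ∑ i, (c i : ℝ) := by
  have := (integral_discreteMeasure c z fun _ => (1 : ℝ)).2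
  simpa using this

/-- The bound by `n` keeps the weight at 0 nonnegative, so `ENNReal.ofReal` does not truncate it. -/
lemma integral_poissonStep {E : Type*} [NormedAddCommGroup E] [NormedSpace ℝ E]
    [CompleteSpace E] (f : ℝ → E) {n : ℕ} (hn : n ≠ 0) (hcn : ∑ i, (c i : ℝ) ≤ n) :
    ∫ x, f x ∂(poissonStep (discreteMeasure c z) n) =
      (1 - (∑ i, (c i : ℝ)) / n) • f 0 + (n : ℝ)⁻¹ • ∑ i, (c i : ℝ) • f (z i) := by
  have hn' : (n : ℝ≥0∞)⁻¹ ≠ ∞ := by simpa using hn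
  rw [poissonStep, integral_add_measure, integral_smul_measure, integral_smul_measure,
    integral_dirac, (integral_discreteMeasure c z f).2, discreteMeasure_real_univ,
    ENNReal.toReal_ofReal, ENNReal.toReal_inv, ENNReal.toReal_natCast]
  · rw [sub_nonneg]
    exact div_le_one_of_le₀ hcn (Nat.cast_nonneg n)
  · exact (integrable_dirac (by simp)).smul_measure ENNReal.ofReal_ne_top
  · exact (integral_discreteMeasure c z f).1.smul_measure hn'

lemma isFiniteMeasure_poissonStep {n : ℕ} (hn : n ≠ 0) :
    IsFiniteMeasure (poissonStep (discreteMeasure c z) n) := by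
  have hn' : (n : ℝ≥0∞)⁻¹ ≠ ∞ := by simpa using hn
  have h1 := (Measure.dirac (0 : ℝ)).smul_finite
    (ENNReal.ofReal_ne_top (r := 1 - (discreteMeasure c z).real Set.univ / n))
  have h2 := (discreteMeasure c z).smul_finite hn'
  rw [poissonStep]
  infer_instance

lemma isProbabilityMeasure_poissonStep {n : ℕ} (hn : n ≠ 0) (hcn : ∑ i, (c i : ℝ) ≤ n) :
    IsProbabilityMeasure (poissonStep (discreteMeasure c z) n) := by
  have h := integral_poissonStep c z (fun _ => (1 : ℝ)) hn hcn
  have := isFiniteMeasure_poissonStep c z hn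
  rw [integral_const] at h
  refine ⟨?_⟩
  rw [← ENNReal.toReal_eq_one_iff]
  simp only [smul_eq_mul, mul_one] at h
  rw [← Measure.real, h]
  ring

lemma poissonStep_compact_support (n : ℕ) :
    ∃ K : Set ℝ, IsCompact K ∧ poissonStep (discreteMeasure c z) n Kᶜ = 0 := by
  refine ⟨insert 0 (Set.range z), ((Set.finite_range z).insert 0).isCompact, ?_⟩
  simp [poissonStep, discreteMeasure]

lemma eventually_le_natCast : ∀ᶠ n : ℕ in atTop, n ≠ 0 ∧ ∑ i, (c i : ℝ) ≤ n :=
  (eventually_ne_atTop 0).and (tendsto_natCast_atTop_atTop.eventually_ge_atTop _)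

end PoissonStep

/-! ### The classical case -/

section Classical

lemma isProbabilityMeasure_convPow (μ : Measure ℝ) [IsProbabilityMeasure μ] (n : ℕ) :
    IsProbabilityMeasure (convPow μ n) := by
  induction n with
  | zero => rw [convPow]; infer_instance
  | succ n ih => rw [convPow]; infer_instance

lemma charFun_convPow (μ : Measure ℝ) [IsProbabilityMeasure μ] (n : ℕ) (t : ℝ) :
    charFun (convPow μ n) t = charFun μ t ^ n := by
  induction n with
  | zero => simp [convPow]
  | succ n ih =>
    have := isProbabilityMeasure_convPow μ n
    rw [convPow, charFun_conv, ih, pow_succ]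

variable {s : ℕ} (c : Fin s → ℝ≥0) (z : Fin s → ℝ)

lemma charFun_poissonStep {n : ℕ} (hn : n ≠ 0) (hcn : ∑ i, (c i : ℝ) ≤ n) (t : ℝ) :
    charFun (poissonStep (discreteMeasure c z) n) t =
      1 + (∑ i, (c i : ℂ) * (Complex.exp (t * z i * Complex.I) - 1)) / n := by
  rw [charFun_apply_real, integral_poissonStep c z _ hn hcn]
  simp only [Complex.real_smul, mul_sub, Finset.sum_sub_distrib, mul_one]
  push_cast
  simp only [mul_zero, zero_mul, Complex.exp_zero, mul_one]
  ring

lemma charFun_map_sum_poisson {Ω : Type*} [MeasurableSpace Ω] {P : Measure Ω}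
    [IsProbabilityMeasure P] {α : Fin s → Ω → ℝ}
    (hα : ∀ i, HasLaw (α i) ((poissonMeasure (c i)).map (Nat.cast : ℕ → ℝ)) P)
    (hind : iIndepFun α P) (t : ℝ) :
    charFun (P.map fun ω => ∑ i, z i * α i ω) t =
      Complex.exp (∑ i, (c i : ℂ) * (Complex.exp (t * z i * Complex.I) - 1)) := by
  have hind' : iIndepFun (fun i ω => z i * α i ω) P :=
    hind.comp (fun i x => z i * x) fun i => measurable_const_mul (z i)
  rw [hind'.charFun_map_fun_sum_eq_prod fun i => (hα i).aemeasurable.const_mul (z i),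
    Finset.prod_apply, Complex.exp_sum]
  refine Finset.prod_congr rfl fun i _ => ?_
  rw [charFun_map_mul_comp (hα i).aemeasurable, (hα i).map_eq, charFun_map_cast_poissonMeasure]
  push_cast
  ring_nf

lemma exists_charFun_eq_exp : ∃ p : ProbabilityMeasure ℝ, ∀ t, charFun (p : Measure ℝ) t =
    Complex.exp (∑ i, (c i : ℂ) * (Complex.exp (t * z i * Complex.I) - 1)) := by
  let μ : Fin s → Measure ℝ := fun i => (poissonMeasure (c i)).map (Nat.cast : ℕ → ℝ)
  have : ∀ i, IsProbabilityMeasure (μ i) := fun i =>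
    Measure.isProbabilityMeasure_map measurable_from_nat.aemeasurable
  have hlaw : ∀ i, HasLaw (fun ω : Fin s → ℝ => ω i) (μ i) (Measure.pi μ) := fun i =>
    ⟨(measurable_pi_apply i).aemeasurable, (measurePreserving_eval μ i).map_eq⟩
  have hind : iIndepFun (fun (i : Fin s) (ω : Fin s → ℝ) => ω i) (Measure.pi μ) :=
    iIndepFun_pi (X := fun _ x => x) fun i => aemeasurable_id
  have hm : Measurable fun ω : Fin s → ℝ => ∑ i, z i * ω i :=
    Finset.measurable_fun_sum _ fun i _ =>
      Measurable.const_mul (f := fun ω : Fin s → ℝ => ω i) (measurable_pi_apply i) (z i)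
  exact ⟨⟨(Measure.pi μ).map fun ω => ∑ i, z i * ω i, Measure.isProbabilityMeasure_map
    hm.aemeasurable⟩, charFun_map_sum_poisson c z hlaw hind⟩

lemma tendsto_convPow_poissonStep {ν : ℕ → ProbabilityMeasure ℝ} {p : ProbabilityMeasure ℝ}
    (hν : ∀ᶠ n in atTop, (ν n : Measure ℝ) = convPow (poissonStep (discreteMeasure c z) n) n)
    (hp : ∀ t, charFun (p : Measure ℝ) t =
      Complex.exp (∑ i, (c i : ℂ) * (Complex.exp (t * z i * Complex.I) - 1))) :
    Tendsto ν atTop (𝓝 p) := by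
  rw [ProbabilityMeasure.tendsto_iff_tendsto_charFun]
  intro t
  rw [hp]
  refine (Complex.tendsto_one_add_div_pow_exp _).congr' ?_
  filter_upwards [hν, eventually_le_natCast c] with n hn hcn
  have := isProbabilityMeasure_poissonStep c z hcn.1 hcn.2
  rw [hn, charFun_convPow, charFun_poissonStep c z hcn.1 hcn.2]

/-- Every admissible sequence has the limit with this characteristic function, and that limit exists
as the law of ∑ z_i α_i on a product of Poisson spaces. -/
lemma isCompoundPoissonLaw_iff {p : ProbabilityMeasure ℝ} :
    IsCompoundPoissonLaw (discreteMeasure c z) p ↔ ∀ t, charFun (p : Measure ℝ) t =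
      Complex.exp (∑ i, (c i : ℂ) * (Complex.exp (t * z i * Complex.I) - 1)) := by
  constructor
  · rintro ⟨ν, hν, hνp⟩
    obtain ⟨q, hq⟩ := exists_charFun_eq_exp c z
    rwa [tendsto_nhds_unique hνp (tendsto_convPow_poissonStep c z hν hq)]
  · intro hp
    have h : ∀ n : ℕ, ∃ ν : ProbabilityMeasure ℝ, (n ≠ 0 ∧ ∑ i, (c i : ℝ) ≤ n) →
        (ν : Measure ℝ) = convPow (poissonStep (discreteMeasure c z) n) n := by
      intro n
      by_cases hn : n ≠ 0 ∧ ∑ i, (c i : ℝ) ≤ n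
      · have := isProbabilityMeasure_poissonStep c z hn.1 hn.2
        exact ⟨⟨_, isProbabilityMeasure_convPow _ n⟩, fun _ => rfl⟩
      -- An arbitrary value: finitely many `n` do not affect the limit.
      · exact ⟨p, fun h => absurd h hn⟩
    choose ν hν using h
    have hν' := (eventually_le_natCast c).mono hν
    exact ⟨ν, hν', tendsto_convPow_poissonStep c z hν' hp⟩

theorem existsUnique_isCompoundPoissonLaw :
    ∃! p : ProbabilityMeasure ℝ, IsCompoundPoissonLaw (discreteMeasure c z) p := by
  obtain ⟨p, hp⟩ := exists_charFun_eq_exp c z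
  refine ⟨p, (isCompoundPoissonLaw_iff c z).2 hp, fun q hq => ?_⟩
  refine Subtype.ext (Measure.ext_of_charFun (μ := (q : Measure ℝ)) (ν := (p : Measure ℝ)) ?_)
  funext t
  rw [(isCompoundPoissonLaw_iff c z).1 hq, ← hp]

variable {c z} in
theorem IsCompoundPoissonLaw.hasLaw_sum {p : ProbabilityMeasure ℝ}
    (hp : IsCompoundPoissonLaw (discreteMeasure c z) p) {Ω : Type*} [MeasurableSpace Ω]
    {P : Measure Ω} [IsProbabilityMeasure P] {α : Fin s → Ω → ℝ}
    (hα : ∀ i, HasLaw (α i) ((poissonMeasure (c i)).map (Nat.cast : ℕ → ℝ)) P)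
    (hind : iIndepFun α P) : HasLaw (fun ω => ∑ i, z i * α i ω) (p : Measure ℝ) P := by
  have hm : AEMeasurable (fun ω => ∑ i, z i * α i ω) P :=
    Finset.aemeasurable_fun_sum _ fun i _ => (hα i).aemeasurable.const_mul (z i)
  have := Measure.isProbabilityMeasure_map hm
  refine ⟨hm, Measure.ext_of_charFun ?_⟩
  funext t
  rw [charFun_map_sum_poisson c z hα hind, (isCompoundPoissonLaw_iff c z).1 hp]

end Classical

/-! ### The free case -/

section FreeCase

/-- The moments of a measure, as complex numbers. -/
noncomputable def complexMoment (μ : Measure ℝ) (k : ℕ) : ℂ := ((∫ x, x ^ k ∂μ : ℝ) : ℂ)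

lemma complexMoment_zero (μ : Measure ℝ) [IsProbabilityMeasure μ] : complexMoment μ 0 = 1 := by
  simp [complexMoment]

lemma HasNCLaw.moments_eq {A : Type*} [Ring A] [Algebra ℂ A] {φ : A →ₗ[ℂ] ℂ} {a : A}
    {μ : Measure ℝ} (h : HasNCLaw φ a μ) : (fun k => φ (a ^ k)) = complexMoment μ :=
  funext h.moment_eq

lemma isFreeCumulants_dirac_zero : IsFreeCumulants (complexMoment (Measure.dirac 0)) 0 := by
  have : complexMoment (Measure.dirac 0) = fun k => 0 ^ k := by
    funext k
    simp [complexMoment]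
  rw [this]
  exact isFreeCumulants_zero

lemma IsFreeConv.isFreeCumulants {μ ν τ : Measure ℝ} (h : IsFreeConv μ ν τ) {R S : ℕ → ℂ}
    (hμ : IsFreeCumulants (complexMoment μ) R) (hν : IsFreeCumulants (complexMoment ν) S) :
    IsFreeCumulants (complexMoment τ) (R + S) := by
  obtain ⟨A, _, _, _, _, φ, a, b, hφ, -, -, hfree, ha, hb, hab⟩ := h
  rw [← ha.moments_eq] at hμ
  rw [← hb.moments_eq] at hν
  have := hfree.isFreeCumulants_sum hφ.map_one (R := ![R, S]) (fun i => by
    fin_cases i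
    · exact hμ
    · exact hν)
  rw [Fin.sum_univ_two, Fin.sum_univ_two] at this
  rw [← hab.moments_eq]
  exact this

lemma IsFreeConvPow.isFreeCumulants {μ : Measure ℝ} {R : ℕ → ℂ}
    (hμ : IsFreeCumulants (complexMoment μ) R) {n : ℕ} {τ : Measure ℝ}
    (h : IsFreeConvPow μ n τ) : IsFreeCumulants (complexMoment τ) (n • R) := by
  induction n generalizing τ with
  | zero =>
    rw [show τ = Measure.dirac 0 from h, zero_smul]
    exact isFreeCumulants_dirac_zero
  | succ n ih =>
    obtain ⟨σ, hσ, hτ⟩ := h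
    rw [succ_nsmul]
    exact hτ.isFreeCumulants (ih hσ) hμ

lemma dirac_zero_compact_support :
    ∃ K : Set ℝ, IsCompact K ∧ (Measure.dirac (0 : ℝ)) Kᶜ = 0 :=
  ⟨{0}, isCompact_singleton, by simp⟩

lemma IsFreeConvPow.compact_support {μ : Measure ℝ} {n : ℕ} {τ : Measure ℝ}
    (h : IsFreeConvPow μ n τ) : ∃ K : Set ℝ, IsCompact K ∧ τ Kᶜ = 0 := by
  cases n with
  | zero =>
    rw [show τ = Measure.dirac 0 from h]
    exact dirac_zero_compact_support
  | succ n =>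
    obtain ⟨σ, -, A, _, _, _, _, φ, a, b, -, -, -, -, -, -, hab⟩ := h
    exact hab.compact_support

lemma AreFree.sum_range {A : Type*} [Ring A] [Algebra ℂ A] {φ : A →ₗ[ℂ] ℂ} (h1 : φ 1 = 1)
    {x : ℕ → A} (hx : AreFree φ x) (n : ℕ) :
    AreFree φ ![∑ i ∈ Finset.range n, x i, x n] := by
  have hadj : ∀ {T : Set ℕ} {i : ℕ}, i ∈ T → x i ∈ Algebra.adjoin ℂ (x '' T) := fun hi =>
    Algebra.subset_adjoin (Set.mem_image_of_mem x hi)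
  refine hx.of_mem_adjoin h1 (T := ![Set.Iio n, {n}]) ?_ ?_
  · intro i j hij
    fin_cases i <;> fin_cases j <;> simp_all [Function.onFun]
  · rw [Fin.forall_fin_two]
    exact ⟨Subalgebra.sum_mem _ fun i hi => hadj (Set.mem_Iio.2 (Finset.mem_range.1 hi)),
      hadj (Set.mem_singleton n)⟩

lemma AreFree.smul {A ι : Type*} [Ring A] [Algebra ℂ A] {φ : A →ₗ[ℂ] ℂ} {x : ι → A}
    (hx : AreFree φ x) (z : ι → ℂ) : AreFree φ fun i => z i • x i := by
  intro l hl hch hcen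
  refine hx l hl hch fun p hp => ⟨?_, (hcen p hp).2⟩
  have hle : Algebra.adjoin ℂ {z p.1 • x p.1} ≤ Algebra.adjoin ℂ {x p.1} :=
    Algebra.adjoin_le (Set.singleton_subset_iff.2
      (Subalgebra.smul_mem _ (Algebra.self_mem_adjoin_singleton ℂ (x p.1)) (z p.1)))
  exact hle (hcen p hp).1

/-- The free convolution powers of a finitely supported law exist. -/
theorem exists_isFreeConvPow {μ : Measure ℝ} [IsProbabilityMeasure μ]
    (hμ : ∃ K : Set ℝ, IsCompact K ∧ μ Kᶜ = 0) {s : ℕ} {w : Fin (s + 1) → ℝ≥0}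
    (hw : ∑ g, w g = 1) {z : Fin (s + 1) → ℝ} (hmom : ∀ k : ℕ, ∫ x, x ^ k ∂μ = ∑ g, w g * z g ^ k)
    (n : ℕ) : ∃ τ : ProbabilityMeasure ℝ, IsFreeConvPow μ n (τ : Measure ℝ) := by
  obtain ⟨H, _, _, _, Ω, x, hΩ, hx, hfree, hxm⟩ := exists_free_selfAdjoint_family s w hw z
  have hφ := isNCState_vectorState hΩ
  have hsum : ∀ n, IsSelfAdjoint (∑ i ∈ Finset.range n, x i) := fun n =>
    isSelfAdjoint_sum _ fun i _ => hx i
  have hlaw : ∀ i, HasNCLaw (vectorState Ω) (x i) μ := fun i =>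
    ⟨inferInstance, hμ, fun k => by rw [hxm, hmom]⟩
  -- One free family serves all powers: its partial sums have laws, and each is free from the next
  -- variable.
  have key : ∀ n, ∃ τ : Measure ℝ, IsFreeConvPow μ n τ ∧
      HasNCLaw (vectorState Ω) (∑ i ∈ Finset.range n, x i) τ := by
    intro n
    induction n with
    | zero =>
      refine ⟨Measure.dirac 0, rfl, inferInstance, dirac_zero_compact_support, fun k => ?_⟩
      rw [Finset.range_zero, Finset.sum_empty, integral_dirac]
      cases k with
      | zero => rw [pow_zero, pow_zero, hφ.map_one, Complex.ofReal_one]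
      | succ k => rw [zero_pow k.succ_ne_zero, zero_pow k.succ_ne_zero, map_zero,
          Complex.ofReal_zero]
    | succ n ih =>
      obtain ⟨σ, hσ, hσx⟩ := ih
      obtain ⟨τ, hτ⟩ := exists_hasNCLaw_vectorState hΩ (hsum (n + 1))
      refine ⟨τ, ⟨σ, hσ, H →L[ℂ] H, inferInstance, inferInstance, inferInstance, inferInstance,
        vectorState Ω, _, _, hφ, hsum n, hx n,
        hfree.sum_range hφ.map_one n, hσx, hlaw n, ?_⟩, hτ⟩
      rwa [Finset.sum_range_succ] at hτ
  obtain ⟨τ, hτ, hτx⟩ := key n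
  exact ⟨⟨τ, hτx.isProbabilityMeasure⟩, hτ⟩

variable {s : ℕ} (c : Fin s → ℝ≥0) (z : Fin s → ℝ)

lemma exists_isFreeConvPow_poissonStep {n : ℕ} (hn : n ≠ 0) (hcn : ∑ i, (c i : ℝ) ≤ n) :
    ∃ τ : ProbabilityMeasure ℝ,
      IsFreeConvPow (poissonStep (discreteMeasure c z) n) n (τ : Measure ℝ) := by
  have := isProbabilityMeasure_poissonStep c z hn hcn
  have hcn' : (∑ i, c i) / n ≤ 1 := div_le_one_of_le₀ (by exact_mod_cast hcn) (Nat.cast_nonneg n)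
  refine exists_isFreeConvPow (poissonStep_compact_support c z n)
    -- The extra index is the atom at 0 with the remaining mass.
    (w := Fin.cons (1 - (∑ i, c i) / n) fun i => c i / n) (z := Fin.cons 0 z) ?_ (fun k => ?_) n
  · rw [Fin.sum_univ_succ]
    simp only [Fin.cons_zero, Fin.cons_succ]
    rw [← Finset.sum_div, tsub_add_cancel_of_le hcn']
  · rw [integral_poissonStep c z _ hn hcn, Fin.sum_univ_succ]
    simp only [Fin.cons_zero, Fin.cons_succ, smul_eq_mul, NNReal.coe_sub hcn', Finset.mul_sum]
    push_cast
    congr 1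
    exact Finset.sum_congr rfl fun i _ => by ring

lemma complexMoment_poissonStep {n : ℕ} (hn : n ≠ 0) (hcn : ∑ i, (c i : ℝ) ≤ n) (k : ℕ) :
    complexMoment (poissonStep (discreteMeasure c z) n) (k + 1) =
      (n : ℂ)⁻¹ * ∑ i, (c i : ℂ) * (z i : ℂ) ^ (k + 1) := by
  rw [complexMoment, integral_poissonStep c z _ hn hcn]
  simp

/-- The law with free cumulants `∑ i, c i * z i ^ n` is the limit of the free convolution
powers. -/
lemma tendsto_isFreeConvPow_poissonStep {ν : ℕ → ProbabilityMeasure ℝ} {π : ProbabilityMeasure ℝ}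
    (hν : ∀ᶠ n in atTop,
      IsFreeConvPow (poissonStep (discreteMeasure c z) n) n (ν n : Measure ℝ))
    (hπ : ∃ K : Set ℝ, IsCompact K ∧ (π : Measure ℝ) Kᶜ = 0)
    (hR : IsFreeCumulants (complexMoment π) fun n => ∑ i, (c i : ℂ) * (z i : ℂ) ^ (n + 1)) :
    Tendsto ν atTop (𝓝 π) := by
  refine tendsto_of_tendsto_moments (hν.mono fun n hn => hn.compact_support) hπ fun k => ?_
  -- `R n` holds the cumulants of one step, so the `n`-th free power has cumulants `n • R n`; below,
  -- ε = 1/n.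
  set R : ℕ → ℕ → ℂ := fun n =>
    freeCumulant (complexMoment (poissonStep (discreteMeasure c z) n)) with hRdef
  have hlim : ∀ j, Tendsto (fun n : ℕ => (n • R n) j) atTop
      (𝓝 (∑ i, (c i : ℂ) * (z i : ℂ) ^ (j + 1))) := by
    intro j
    have h := tendsto_freeCumulant_of_small (l := atTop) (ε := fun n : ℕ => (n : ℂ)⁻¹)
      (m := fun n => complexMoment (poissonStep (discreteMeasure c z) n))
      (r := fun k => ∑ i, (c i : ℂ) * (z i : ℂ) ^ k)
      (tendsto_inv_atTop_nhds_zero_nat (𝕜 := ℂ))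
      ((eventually_ne_atTop 0).mono fun n hn => by simpa using hn)
      ((eventually_le_natCast c).mono fun n hn k => complexMoment_poissonStep c z hn.1 hn.2 k) j
    refine h.congr fun n => ?_
    simp [R]
  have hmom := IsFreeCumulants.tendsto (l := atTop) (m := fun n => complexMoment (ν n))
    (R := fun n => n • R n) ?_ hR hlim k
  · have h := (Complex.continuous_re.tendsto _).comp hmom
    simpa [complexMoment, Function.comp_def] using h
  · filter_upwards [hν, eventually_le_natCast c] with n hn hcn
    have := isProbabilityMeasure_poissonStep c z hcn.1 hcn.2
    exact hn.isFreeCumulants (isFreeCumulants_freeCumulant (complexMoment_zero _))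

/-- All admissible sequences converge to the Fock space law, so limits inherit its support and
cumulants. Conversely, compact support and these cumulants are what the method of moments requires.
-/
lemma isCompoundFreePoissonLaw_iff {π : ProbabilityMeasure ℝ} :
    IsCompoundFreePoissonLaw (discreteMeasure c z) π ↔
      (∃ K : Set ℝ, IsCompact K ∧ (π : Measure ℝ) Kᶜ = 0) ∧
        IsFreeCumulants (complexMoment π) fun n => ∑ i, (c i : ℂ) * (z i : ℂ) ^ (n + 1) := by
  constructor
  · rintro ⟨ν, hν, hνπ⟩
    obtain ⟨μ, hμ, hμc, hμR⟩ := exists_isFreeCumulants_sum_pow c z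
    have := tendsto_isFreeConvPow_poissonStep c z (π := ⟨μ, hμ⟩) hν hμc hμR
    rw [tendsto_nhds_unique hνπ this]
    exact ⟨hμc, hμR⟩
  · rintro ⟨hπ, hR⟩
    have h : ∀ n : ℕ, ∃ ν : ProbabilityMeasure ℝ, (n ≠ 0 ∧ ∑ i, (c i : ℝ) ≤ n) →
        IsFreeConvPow (poissonStep (discreteMeasure c z) n) n (ν : Measure ℝ) := by
      intro n
      by_cases hn : n ≠ 0 ∧ ∑ i, (c i : ℝ) ≤ n
      · obtain ⟨τ, hτ⟩ := exists_isFreeConvPow_poissonStep c z hn.1 hn.2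
        exact ⟨τ, fun _ => hτ⟩
      · exact ⟨π, fun h => absurd h hn⟩
    choose ν hν using h
    have hν' := (eventually_le_natCast c).mono hν
    exact ⟨ν, hν', tendsto_isFreeConvPow_poissonStep c z hν' hπ hR⟩

theorem existsUnique_isCompoundFreePoissonLaw :
    ∃! π : ProbabilityMeasure ℝ, IsCompoundFreePoissonLaw (discreteMeasure c z) π := by
  obtain ⟨μ, hμ, hμc, hμR⟩ := exists_isFreeCumulants_sum_pow c z
  refine ⟨⟨μ, hμ⟩, (isCompoundFreePoissonLaw_iff c z).2 ⟨hμc, hμR⟩, ?_⟩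
  rintro π ⟨ν, hν, hνπ⟩
  exact tendsto_nhds_unique hνπ
    (tendsto_isFreeConvPow_poissonStep c z (π := ⟨μ, hμ⟩) hν hμc hμR)

/-- The case of one atom at 1: all powers of the atom are 1, so every cumulant is `c`. -/
lemma IsFreePoissonLaw.isFreeCumulants {c : ℝ≥0} {m : ProbabilityMeasure ℝ}
    (h : IsFreePoissonLaw c m) : IsFreeCumulants (complexMoment m) fun _ => (c : ℂ) := by
  have h1 : c • Measure.dirac (1 : ℝ) = discreteMeasure (fun _ : Fin 1 => c) fun _ => 1 := by
    simp [discreteMeasure]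
  rw [IsFreePoissonLaw, h1, isCompoundFreePoissonLaw_iff] at h
  simpa using h.2

variable {c z} in
theorem IsCompoundFreePoissonLaw.hasNCLaw_sum {π : ProbabilityMeasure ℝ}
    (hπ : IsCompoundFreePoissonLaw (discreteMeasure c z) π) {A : Type*} [Ring A] [Algebra ℂ A]
    {φ : A →ₗ[ℂ] ℂ} (h1 : φ 1 = 1) {α : Fin s → A}
    (hα : ∀ i, ∃ m : ProbabilityMeasure ℝ,
      IsFreePoissonLaw (c i) m ∧ HasNCLaw φ (α i) (m : Measure ℝ))
    (hfree : AreFree φ α) : HasNCLaw φ (∑ i, (z i : ℂ) • α i) (π : Measure ℝ) := by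
  rw [isCompoundFreePoissonLaw_iff] at hπ
  have hscale := hfree.smul fun i => (z i : ℂ)
  have hcum : ∀ i, IsFreeCumulants (fun k => φ (((z i : ℂ) • α i) ^ k))
      fun n => (z i : ℂ) ^ (n + 1) * (c i : ℂ) := by
    intro i
    obtain ⟨m, hm, hmα⟩ := hα i
    have h2 := hm.isFreeCumulants.rescale (z i)
    rw [← hmα.moments_eq] at h2
    simpa [smul_pow] using h2
  have hsum := hscale.isFreeCumulants_sum h1 hcum
  have heq : (∑ i, fun n => (z i : ℂ) ^ (n + 1) * (c i : ℂ)) =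
      fun n => ∑ i, (c i : ℂ) * (z i : ℂ) ^ (n + 1) := by
    funext n
    simp [Finset.sum_apply, mul_comm]
  rw [heq] at hsum
  -- `π` already supplies a compactly supported probability measure; only the moments need
  -- comparing, and equal cumulants force them to agree.
  exact ⟨inferInstance, hπ.1, congrFun (hsum.unique hπ.2)⟩

end FreeCase

theorem theorem4p4 {s : ℕ} (c : Fin s → ℝ≥0) (hc : ∀ i, 0 < c i) (z : Fin s → ℝ) :
    -- the classical case
    ((∃! p : ProbabilityMeasure ℝ, IsCompoundPoissonLaw (discreteMeasure c z) p) ∧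
      ∀ p : ProbabilityMeasure ℝ, IsCompoundPoissonLaw (discreteMeasure c z) p →
        ∀ (Ω : Type*) [MeasurableSpace Ω] (P : Measure Ω) [IsProbabilityMeasure P]
          (α : Fin s → Ω → ℝ),
          (∀ i, HasLaw (α i) ((poissonMeasure (c i)).map (Nat.cast : ℕ → ℝ)) P) →
          iIndepFun α P →
          HasLaw (fun ω => ∑ i, z i * α i ω) (p : Measure ℝ) P) ∧
    -- the free case
    ((∃! π : ProbabilityMeasure ℝ, IsCompoundFreePoissonLaw (discreteMeasure c z) π) ∧
      ∀ π : ProbabilityMeasure ℝ, IsCompoundFreePoissonLaw (discreteMeasure c z) π →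
        ∀ (A : Type*) [Ring A] [StarRing A] [Algebra ℂ A] [StarModule ℂ A]
          (φ : A →ₗ[ℂ] ℂ) (α : Fin s → A),
          IsNCState φ →
          (∀ i, IsSelfAdjoint (α i)) →
          (∀ i, ∃ m : ProbabilityMeasure ℝ,
            IsFreePoissonLaw (c i) m ∧ HasNCLaw φ (α i) (m : Measure ℝ)) →
          AreFree φ α →
          HasNCLaw φ (∑ i, (z i : ℂ) • α i) (π : Measure ℝ)) := by
  refine ⟨⟨existsUnique_isCompoundPoissonLaw c z, fun p hp Ω _ P _ α hα hind =>
    hp.hasLaw_sum hα hind⟩, existsUnique_isCompoundFreePoissonLaw c z,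
    fun π hπ A _ _ _ _ φ α hφ _ hα hfree => hπ.hasNCLaw_sum hφ.map_one hα hfree⟩
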